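/- For $s=\sigma+it\in\mathbb C$ let $$\mathcal R(s)=\int_{0\swarrow1}\frac{x^{-s}e^{\pi i x^2}}{e^{\pi i x}-e^{-\pi i x}}\,dx$$ be Riemann's auxiliary function, where $0\swarrow1$ denotes the straight line of direction $e^{-3\pi i/4}$ crossing the real axis between $0$ and $1$ (say $x=\frac12+ue^{-3\pi i/4}$ with $u$ increasing from $-\infty$ to $+\infty$) and $x^{-s}$ is the principal branch. Let $\chi(s)=2^s\pi^{s-1}\sin(\pi s/2)\Gamma(1-s)$ be the factor of the functional equation $\zeta(s)=\chi(s)\zeta(1-s)$. For $0<\arg(s-1)<2\pi$ let $\eta=\eta(s)$ be the square root of $\frac{s-1}{2\pi i}$ with $-\frac{\pi}{4}<\arg\eta<\frac{3\pi}{4}$, and let $\eta^{s-1}$ be the principal power. Then there are constants $A>0$, $t_0>0$ and $C>0$ such that for every $s=\sigma+it$ with $t>t_0$ and $1-\sigma\ge A\,t^{2/5}\log t$ we have $$\mathcal R(s)=-\chi(s)\,\eta^{s-1}e^{-\pi i\eta^2}\,\frac{\sqrt2\,e^{3\pi i/8}\sin\pi\eta}{2\cos2\pi\eta}\,(1+U)$$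 with a complex number $U=U(s)$ satisfying $|U|<1$ and $|U|\le C(\log t)^{-1/5}$. -/

import Mathlib

noncomputable section

namespace RiemannAux

open Complex MeasureTheory

/-- The integrand `x^{-s} e^{π i x²} / (e^{π i x} - e^{-π i x})`, with the principal branch of
`x^{-s}` (the path of integration below does not meet the cut `(-∞, 0]`). -/
def kernel (s x : ℂ) : ℂ :=
  x ^ (-s) * exp (Real.pi * I * x ^ 2) / (exp (Real.pi * I * x) - exp (-(Real.pi * I * x)))

/-- Riemann's auxiliary function `ℛ(s)`: the integral of `kernel s` along `0 ↙ 1`, the line of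
slope `1` that crosses the real axis between `0` and `1` (here at `1/2`), run downwards to the
left. It is parametrized as `x = 1/2 + u e^{-3πi/4}`, `u ∈ ℝ`. -/
def auxR (s : ℂ) : ℂ :=
  ∫ u : ℝ, kernel s (1 / 2 + u * exp (-(3 * Real.pi * I / 4))) * exp (-(3 * Real.pi * I / 4))

/-- The factor `χ(s) = 2^s π^{s-1} sin(πs/2) Γ(1-s)` of the functional equation
`ζ(s) = χ(s) ζ(1-s)`. -/
def chi (s : ℂ) : ℂ :=
  2 ^ s * (Real.pi : ℂ) ^ (s - 1) * sin (Real.pi * s / 2) * Gamma (1 - s)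

/-- The square root `η` of `(s-1)/(2πi)` with `-π/4 < arg η < 3π/4`, for `0 < arg (s-1) < 2π`;
see `eta_sq` and `arg_eta`. -/
def eta (s : ℂ) : ℂ :=
  exp (Real.pi * I / 4) * ((1 - s) / (2 * Real.pi)) ^ (1 / 2 : ℂ)

theorem eta_sq (s : ℂ) : eta s ^ 2 = (s - 1) / (2 * Real.pi * I) := by
  have h1 : exp (Real.pi * I / 4) ^ 2 = I := by
    rw [← Complex.exp_nat_mul, show ((2 : ℕ) : ℂ) * (Real.pi * I / 4) = Real.pi / 2 * I by
      push_cast; ring]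
    exact exp_pi_div_two_mul_I
  have h2 : (((1 - s) / (2 * Real.pi)) ^ (1 / 2 : ℂ)) ^ 2 = (1 - s) / (2 * Real.pi) := by
    simp
  have hp : (Real.pi : ℂ) ≠ 0 := by exact_mod_cast Real.pi_ne_zero
  rw [eta, mul_pow, h1, h2]
  field_simp [I_ne_zero]
  rw [I_sq]
  ring

/-- The hypothesis says that `s - 1` is not in `[0, ∞)`, that is, that its argument can be taken
in `(0, 2π)`. -/
theorem arg_eta (s : ℂ) (hs : 1 - s ∈ slitPlane) :
    arg (eta s) ∈ Set.Ioo (-(Real.pi / 4)) (3 * Real.pi / 4) := by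
  have hpi := Real.pi_pos
  set z : ℂ := (1 - s) / (2 * Real.pi) with hz
  have hz' : z = ((2 * Real.pi)⁻¹ : ℝ) * (1 - s) := by
    rw [hz]; push_cast; rw [div_eq_inv_mul]
  have harg : arg z = arg (1 - s) := by
    rw [hz', arg_real_mul _ (by positivity)]
  have hlt : arg z < Real.pi := by
    rw [harg]
    exact lt_of_le_of_ne (arg_le_pi _) (mem_slitPlane_iff_arg.1 hs).1
  have hgt : -Real.pi < arg z := neg_pi_lt_arg z
  have hz0 : z ≠ 0 := by
    rw [hz']
    refine mul_ne_zero ?_ (slitPlane_ne_zero hs)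
    exact_mod_cast (by positivity : ((2 * Real.pi)⁻¹ : ℝ) ≠ 0)
  have key : eta s = exp ((Real.log ‖z‖ / 2 : ℝ) + ((Real.pi / 4 + arg z / 2 : ℝ)) * I) := by
    rw [eta, ← hz, cpow_def_of_ne_zero hz0, ← Complex.exp_add, log]
    congr 1
    push_cast
    ring
  have : arg (eta s) = Real.pi / 4 + arg z / 2 := by
    rw [key, Complex.exp_add, ← ofReal_exp, arg_real_mul _ (Real.exp_pos _),
      arg_exp_mul_I, toIocMod_eq_self]
    constructor <;> linarith
  rw [this]
  constructor <;> linarith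

/-- The main term
`-χ(s) η^{s-1} e^{-π i η²} · √2 e^{3πi/8} sin(πη) / (2 cos(2πη))`, `η = η(s)`. -/
def mainTerm (s : ℂ) : ℂ :=
  -chi s * eta s ^ (s - 1) * exp (-(Real.pi * I * eta s ^ 2)) *
    ((Real.sqrt 2 : ℂ) * exp (3 * Real.pi * I / 8) * sin (Real.pi * eta s) /
      (2 * cos (2 * Real.pi * eta s)))

end RiemannAux

end

namespace RiemannAux

open Complex MeasureTheory Filter Set

open scoped Real Topology

/-! The saddle-point method, applied to an exact dual formula rather than to the defining integral.
For `s.re < -1` the path is moved to the origin. On the ray `y = u e^{πi/4}` Mordell's identity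
`exp_div_sin_eq_lineInt_sub` splits `e^{πi y²}/(2i sin πy)` into an integral over the line of
direction `e^{-πi/4}` through `N + 1/2`, minus the series of `e^{2πi n y}` over `n > N`. Fubini and
Gamma integrals turn this into `auxR_eq_chi_mul`, valid for every `N`: `ℛ(s)` is `χ(s)` times the
tail of `∑ n^{s-1}` minus the line integral of `x^{s-1} e^{-πi x²}/(2i sin πx)`.

The function `x^{s-1} e^{-πi x²}` has its saddle point at `η = X + iy`, where it looks like a
constant times `e^{-2πi(x-η)²}`. As `e^{-πi n²} = (-1)^n`, the terms of the tail are values of the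
same function up to sign. For `N = ⌊X + y⌋` the line passes close to `η`, and both pieces can be
compared with the Gaussian. For the Gaussian itself the difference is exact: a geometric series and
a Mordell integral combine to the trigonometric quotient of the main term, and `N` drops out
(`saddleGauss_sum_sub_lineInt`).

Let `a = min(y, 1)`. The cubic term of the phase costs a factor `1/X`, summation over the tail costs
`a⁻⁴`; so the error is `O(e^{-πy}/(X a⁴))` (`norm_lineInt_sub_le`, `exists_norm_tail_sub_le`). The
quotient is at least `a e^{-πy}/6` (`le_norm_saddle_value`), so the relative error is `O(1/(X a⁵))`.
Finally `1 - σ = 4πXy` and `t = 2π(X² - y²)` make `X a⁵` at least a constant times `log t`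
(`log_le_re_eta_mul`). This even gives `U = O(1/log t)`. -/

/-! ### Contour shifts and a simple pole in a horizontal strip. -/

/-- If `F` is holomorphic in a horizontal strip and decays towards its ends, then the truncated
integrals over the two boundary lines have the same limit. -/
theorem tendsto_strip_integral_sub {F : ℂ → ℂ} {α β : ℝ} (hαβ : α ≤ β)
    (hc : ContinuousOn F {z | z.im ∈ Icc α β})
    (hd : DifferentiableOn ℂ F {z | z.im ∈ Ioo α β})
    {g : ℝ → ℝ} (hg : Tendsto g atTop (𝓝 0))
    (hF : ∀ u τ : ℝ, 1 ≤ |u| → τ ∈ Icc α β → ‖F (u + τ * I)‖ ≤ g |u|) :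
    Tendsto (fun R : ℝ => (∫ u in (-R)..R, F (u + α * I)) - ∫ u in (-R)..R, F (u + β * I))
      atTop (𝓝 0) := by
  have hrect : ∀ R : ℝ, 1 ≤ R →
      (∫ u in (-R)..R, F (u + α * I)) - (∫ u in (-R)..R, F (u + β * I)) =
        I * (∫ τ in α..β, F (((-R : ℝ) : ℂ) + τ * I)) -
          I * (∫ τ in α..β, F ((R : ℂ) + τ * I)) := by
    intro R hR
    have h := integral_boundary_rect_eq_zero_of_continuousOn_of_differentiableOn F
      (⟨-R, α⟩ : ℂ) ⟨R, β⟩ (hc.mono ?_) (hd.mono ?_)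
    · simp only [smul_eq_mul] at h
      linear_combination h
    · intro z hz
      have := hz.2
      rwa [mem_preimage, uIcc_of_le hαβ] at this
    · intro z hz
      have := hz.2
      rwa [mem_preimage, min_eq_left hαβ, max_eq_right hαβ] at this
  have hside : ∀ x : ℝ, 1 ≤ |x| → ‖∫ τ in α..β, F ((x : ℂ) + τ * I)‖ ≤ g |x| * |β - α| := by
    intro x hx
    apply intervalIntegral.norm_integral_le_of_norm_le_const
    intro τ hτ
    rw [uIoc_of_le hαβ] at hτ
    exact hF x τ hx ⟨hτ.1.le, hτ.2⟩
  have hlim : Tendsto (fun R => g R * |β - α| + g R * |β - α|) atTop (𝓝 0) := by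
    simpa using (hg.mul_const |β - α|).add (hg.mul_const |β - α|)
  refine squeeze_zero_norm' ?_ hlim
  filter_upwards [eventually_ge_atTop 1] with R hR
  have hR0 : |R| = R := abs_of_nonneg (by linarith)
  rw [hrect R hR]
  refine (norm_sub_le _ _).trans (add_le_add ?_ ?_)
  · rw [norm_mul, norm_I, one_mul]
    simpa only [abs_neg, hR0] using hside (-R) (by rw [abs_neg, hR0]; exact hR)
  · rw [norm_mul, norm_I, one_mul]
    simpa only [hR0] using hside R (by rw [hR0]; exact hR)

theorem integral_strip_eq {F : ℂ → ℂ} {α β : ℝ} (hαβ : α ≤ β)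
    (hc : ContinuousOn F {z | z.im ∈ Icc α β})
    (hd : DifferentiableOn ℂ F {z | z.im ∈ Ioo α β})
    {g : ℝ → ℝ} (hg : Tendsto g atTop (𝓝 0))
    (hF : ∀ u τ : ℝ, 1 ≤ |u| → τ ∈ Icc α β → ‖F (u + τ * I)‖ ≤ g |u|)
    (hα : Integrable fun u : ℝ => F (u + α * I)) (hβ : Integrable fun u : ℝ => F (u + β * I)) :
    ∫ u : ℝ, F (u + α * I) = ∫ u : ℝ, F (u + β * I) := by
  have h1 := (intervalIntegral_tendsto_integral hα tendsto_neg_atTop_atBot tendsto_id).sub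
    (intervalIntegral_tendsto_integral hβ tendsto_neg_atTop_atBot tendsto_id)
  exact sub_eq_zero.1 (tendsto_nhds_unique h1 (tendsto_strip_integral_sub hαβ hc hd hg hF))

/-- The principal part `1/p` on the two edges of the strip differs by a Poisson kernel, whose
integral is explicit; this replaces the residue theorem. -/
theorem inv_sub_inv_conj {ε u : ℝ} (hε : 0 < ε) :
    1 / ((u : ℂ) + (-ε : ℝ) * I) - 1 / ((u : ℂ) + ε * I) =
      ((2 / ε * (1 + (ε⁻¹ * u) ^ 2)⁻¹ : ℝ) : ℂ) * I := by
  have h1 : (u : ℂ) + (-ε : ℝ) * I ≠ 0 := fun h => by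
    have := congrArg im h; simp at this; linarith
  have h2 : (u : ℂ) + ε * I ≠ 0 := fun h => by
    have := congrArg im h; simp at this; linarith
  have h3 : ((u : ℂ) + (-ε : ℝ) * I) * ((u : ℂ) + ε * I) = ((ε ^ 2 + u ^ 2 : ℝ) : ℂ) := by
    push_cast; linear_combination (-(ε : ℂ) ^ 2) * I_sq
  have h4 : (2 / ε * (1 + (ε⁻¹ * u) ^ 2)⁻¹ : ℝ) = 2 * ε / (ε ^ 2 + u ^ 2) := by
    have : ε ^ 2 + u ^ 2 ≠ 0 := by positivity
    field_simp
  rw [h4, div_sub_div _ _ h1 h2, h3]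
  push_cast
  ring

theorem integrable_poisson (ε : ℝ) (hε : 0 < ε) :
    Integrable fun u : ℝ => ((2 / ε * (1 + (ε⁻¹ * u) ^ 2)⁻¹ : ℝ) : ℂ) * I :=
  (((integrable_inv_one_add_sq.comp_mul_left' (inv_ne_zero hε.ne')).const_mul _).ofReal).mul_const _

theorem integral_poisson (ε : ℝ) (hε : 0 < ε) :
    ∫ u : ℝ, ((2 / ε * (1 + (ε⁻¹ * u) ^ 2)⁻¹ : ℝ) : ℂ) * I = 2 * π * I := by
  rw [integral_mul_const, integral_complex_ofReal, integral_const_mul,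
    Measure.integral_comp_mul_left (fun x : ℝ => (1 + x ^ 2)⁻¹), integral_univ_inv_one_add_sq]
  rw [inv_inv, abs_of_pos hε, smul_eq_mul]
  congr 1
  rw [show 2 / ε * (ε * π) = 2 * π by field_simp]
  push_cast; ring

/-- The residue of a simple pole at `0` in a horizontal strip that is symmetric about `0`. -/
theorem integral_strip_sub_eq_residue {F φ : ℂ → ℂ} {ε : ℝ} (hε : 0 < ε) {V : Set ℂ}
    (hVo : IsOpen V) (hV : {z : ℂ | z.im ∈ Icc (-ε) ε} ⊆ V) (hφ : DifferentiableOn ℂ φ V)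
    (hFφ : ∀ p ∈ V, p ≠ 0 → F p = φ p / p)
    {g : ℝ → ℝ} (hg : Tendsto g atTop (𝓝 0))
    (hF : ∀ u τ : ℝ, 1 ≤ |u| → τ ∈ Icc (-ε) ε → ‖F (u + τ * I)‖ ≤ g |u|)
    (hα : Integrable fun u : ℝ => F (u + (-ε : ℝ) * I))
    (hβ : Integrable fun u : ℝ => F (u + ε * I)) :
    (∫ u : ℝ, F (u + (-ε : ℝ) * I)) - ∫ u : ℝ, F (u + ε * I) = 2 * π * I * φ 0 := by
  have h0V : (0 : ℂ) ∈ V := hV (by simp [hε.le])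
  -- `H = F - φ(0)/p` extends holomorphically over the pole, so its integrals over the two edges
  -- agree; the part `φ(0)/p` is left to the Poisson kernel.
  set H : ℂ → ℂ := dslope φ 0 with hH
  have hHd : DifferentiableOn ℂ H V := (differentiableOn_dslope (hVo.mem_nhds h0V)).2 hφ
  have hHF : ∀ p ∈ V, p ≠ 0 → H p = F p - φ 0 * (1 / p) := by
    intro p hp hp0
    rw [hH, dslope_of_ne _ hp0, slope_def_field, hFφ p hp hp0, sub_zero]
    ring
  have hmem : ∀ u τ : ℝ, τ ∈ Icc (-ε) ε → ((u : ℂ) + τ * I) ∈ V := fun u τ h => hV (by simpa using h)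
  -- `1/p` decays too slowly to be integrable on either edge alone, so truncated integrals are
  -- compared.
  have key := tendsto_strip_integral_sub (F := H) (α := -ε) (β := ε) (by linarith)
    (hHd.continuousOn.mono hV)
    (hHd.mono (fun z hz => hV (Ioo_subset_Icc_self hz)))
    (g := fun x => g x + ‖φ 0‖ * x⁻¹)
    (by simpa using hg.add (tendsto_inv_atTop_zero.const_mul ‖φ 0‖)) (by
      intro u τ hu hτ
      have hre : |u| ≤ ‖(u : ℂ) + τ * I‖ := by
        simpa using abs_re_le_norm ((u : ℂ) + τ * I)
      have hne : (u : ℂ) + τ * I ≠ 0 := by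
        intro h; rw [h, norm_zero] at hre; linarith
      rw [hHF _ (hmem u τ hτ) hne]
      refine (norm_sub_le _ _).trans (add_le_add (hF u τ hu hτ) ?_)
      rw [norm_mul, one_div, norm_inv]
      gcongr)
  have hne : ∀ u τ : ℝ, τ ≠ 0 → (u : ℂ) + τ * I ≠ 0 := fun u τ hτ h => by
    have := congrArg im h; simp at this; exact hτ this
  have hlim := (intervalIntegral_tendsto_integral (hα.sub hβ) tendsto_neg_atTop_atBot
    tendsto_id).sub ((intervalIntegral_tendsto_integral (integrable_poisson ε hε)
      tendsto_neg_atTop_atBot tendsto_id).const_mul (φ 0))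
  have hcontH : ∀ τ ∈ Icc (-ε) ε, Continuous fun u : ℝ => H (u + τ * I) := fun τ hτ =>
    hHd.continuousOn.comp_continuous (by fun_prop) (fun u => hmem u τ hτ)
  have heq : ∀ R : ℝ, (∫ u in (-R)..R, H (u + (-ε : ℝ) * I)) - (∫ u in (-R)..R, H (u + ε * I)) =
      (∫ u in (-R)..(id R), ((fun u : ℝ => F (u + (-ε : ℝ) * I)) - fun u : ℝ => F (u + ε * I)) u) -
        φ 0 * ∫ u in (-R)..(id R), ((2 / ε * (1 + (ε⁻¹ * u) ^ 2)⁻¹ : ℝ) : ℂ) * I := by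
    intro R
    rw [← intervalIntegral.integral_sub
      ((hcontH _ (by constructor <;> linarith)).intervalIntegrable _ _)
      ((hcontH _ (by constructor <;> linarith)).intervalIntegrable _ _),
      ← intervalIntegral.integral_const_mul, ← intervalIntegral.integral_sub
        (hα.sub hβ).intervalIntegrable ((integrable_poisson ε hε).const_mul _).intervalIntegrable]
    apply intervalIntegral.integral_congr
    intro u _
    simp only [Pi.sub_apply]
    rw [hHF _ (hmem u _ (by constructor <;> linarith)) (hne u (-ε) (by linarith)),
      hHF _ (hmem u _ (by constructor <;> linarith)) (hne u ε hε.ne'), ← inv_sub_inv_conj hε]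
    ring
  have h0 := tendsto_nhds_unique (hlim.congr (fun R => (heq R).symm)) key
  rw [integral_poisson ε hε] at h0
  simp only [Pi.sub_apply] at h0
  rw [integral_sub hα hβ] at h0
  linear_combination h0

/-! ### The direction of steepest descent and the size of the sine. -/

/-- The direction `e^{-πi/4}` of steepest descent. -/
noncomputable def rot : ℂ := exp (-(π * I / 4))

theorem rot_eq : rot = (√2 / 2 : ℝ) - (√2 / 2 : ℝ) * I := by
  rw [rot, show -((π : ℂ) * I / 4) = ((-(π / 4) : ℝ) : ℂ) * I by push_cast; ring, exp_mul_I,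
    ← ofReal_cos, ← ofReal_sin, Real.cos_neg, Real.sin_neg, Real.cos_pi_div_four,
    Real.sin_pi_div_four]
  push_cast; ring

@[simp] theorem rot_re : rot.re = √2 / 2 := by
  rw [rot_eq]; simp only [sub_re, mul_re, ofReal_re, ofReal_im, I_re, I_im]; ring

@[simp] theorem rot_im : rot.im = -(√2 / 2) := by
  rw [rot_eq]; simp only [sub_im, mul_im, ofReal_re, ofReal_im, I_re, I_im]; ring

theorem rot_ne_zero : rot ≠ 0 := exp_ne_zero _

theorem rot_sq : rot ^ 2 = -I := by
  rw [rot, ← Complex.exp_nat_mul,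
    show ((2 : ℕ) : ℂ) * -(π * I / 4) = -(π / 2 * I) by push_cast; ring, Complex.exp_neg,
    exp_pi_div_two_mul_I, inv_I]

@[simp] theorem norm_rot : ‖rot‖ = 1 := by
  rw [rot, show -((π : ℂ) * I / 4) = ((-(π / 4) : ℝ) : ℂ) * I by push_cast; ring]
  exact norm_exp_ofReal_mul_I _

theorem sq_norm_sin (z : ℂ) : ‖sin z‖ ^ 2 = Real.sin z.re ^ 2 + Real.sinh z.im ^ 2 := by
  rw [Complex.sin_eq, ← ofReal_sin, ← ofReal_cos, ← ofReal_sinh, ← ofReal_cosh, ← normSq_eq_norm_sq,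
    normSq_apply]
  simp only [add_re, add_im, mul_re, mul_im, ofReal_re, ofReal_im, I_re, I_im]
  nlinarith [Real.sin_sq_add_cos_sq z.re, Real.cosh_sq z.im]

theorem sq_norm_cos (z : ℂ) : ‖cos z‖ ^ 2 = Real.cosh z.im ^ 2 - Real.sin z.re ^ 2 := by
  rw [Complex.cos_eq, ← ofReal_sin, ← ofReal_cos, ← ofReal_sinh, ← ofReal_cosh, ← normSq_eq_norm_sq,
    normSq_apply]
  simp only [mul_re, mul_im, sub_re, sub_im, ofReal_re, ofReal_im, I_re, I_im]
  nlinarith [Real.sin_sq_add_cos_sq z.re, Real.cosh_sq z.im]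

theorem abs_sinh_im_le_norm_sin (z : ℂ) : |Real.sinh z.im| ≤ ‖sin z‖ := by
  apply abs_le_of_sq_le_sq _ (norm_nonneg _)
  rw [sq_norm_sin]; nlinarith [sq_nonneg (Real.sin z.re)]

theorem abs_le_abs_sinh (x : ℝ) : |x| ≤ |Real.sinh x| := by
  rw [Real.abs_sinh]; exact Real.self_le_sinh_iff.2 (abs_nonneg x)

/-- On the line the sine is `±cos(B - iB)`, of squared modulus `cosh² B - sin² B`, and `sin² B ≤
min(1, B²) ≤ (1 + B²)/2 ≤ cosh² B / 2`. -/
theorem half_cosh_le_norm_sin_line (N : ℤ) (v : ℝ) :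
    Real.cosh (π * (√2 / 2) * v) / 2 ≤ ‖sin (π * ((N : ℂ) + 1 / 2 + v * rot))‖ := by
  set B := π * (√2 / 2) * v with hB
  have hz : π * ((N : ℂ) + 1 / 2 + v * rot) = (B - B * I) + π / 2 + N * π := by
    rw [rot_eq, hB]; push_cast; ring
  rw [hz, sin_antiperiodic.add_int_mul_eq, Complex.sin_add_pi_div_two, norm_mul]
  have hunit : ‖(((N.negOnePow : ℤˣ) : ℤ) : ℂ)‖ = 1 := by
    rcases Int.units_eq_one_or N.negOnePow with h | h <;> simp [h]
  rw [hunit, one_mul]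
  apply le_of_sq_le_sq _ (norm_nonneg _)
  have hc := sq_norm_cos (B - B * I)
  simp at hc
  rw [hc]
  have h1 := Real.cosh_sq B
  have h2 : B ^ 2 ≤ Real.sinh B ^ 2 := sq_le_sq.2 (abs_le_abs_sinh B)
  have h3 : Real.sin B ^ 2 ≤ B ^ 2 := sq_le_sq.2 Real.abs_sin_le_abs
  have h4 := Real.sin_sq_le_one B
  nlinarith

theorem half_le_norm_sin_line (N : ℤ) (v : ℝ) :
    1 / 2 ≤ ‖sin (π * ((N : ℂ) + 1 / 2 + v * rot))‖ :=
  le_trans (by linarith [Real.one_le_cosh (π * (√2 / 2) * v)]) (half_cosh_le_norm_sin_line N v)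

theorem sin_line_ne_zero (N : ℤ) (v : ℝ) : sin (π * ((N : ℂ) + 1 / 2 + v * rot)) ≠ 0 := fun h => by
  have := half_le_norm_sin_line N v
  rw [h, norm_zero] at this; norm_num at this

/-! ### Line integrals against `1/(2i sin πx)` and their residues. -/

/-- `∫ Q(x) / (2i sin πx) dx` over the line of direction `e^{-πi/4}` through `c`. -/
noncomputable def lineInt (Q : ℂ → ℂ) (c : ℂ) : ℂ :=
  ∫ v : ℝ, Q (c + v * rot) / (2 * I * sin (π * (c + v * rot))) * rot

theorem integrable_exp_neg_sq : Integrable fun u : ℝ => Real.exp (-u ^ 2) := by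
  simpa using integrable_exp_neg_mul_sq one_pos

theorem sin_rot_eq_zero {p : ℂ} (hp : |p.im| < 1 / 2) (h : sin (π * (rot * p)) = 0) : p = 0 := by
  obtain ⟨k, hk⟩ := Complex.sin_eq_zero_iff.1 h
  have hπ : (π : ℂ) ≠ 0 := by exact_mod_cast Real.pi_ne_zero
  have h1 : rot * p = k := by
    apply mul_left_cancel₀ hπ; rw [hk]; ring
  have h2 : p.im = k * (√2 / 2) := by
    have h3 : -I * p = k * rot := by
      rw [← rot_sq, ← h1]; ring
    have h4 : (-I * p).re = ((k : ℂ) * rot).re := by rw [h3]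
    simpa using h4
  have hs := Real.sq_sqrt (show (0 : ℝ) ≤ 2 by norm_num)
  have hsp := Real.sqrt_nonneg 2
  have hk0 : k = 0 := by
    by_contra hk0
    have h5 : (1 : ℝ) ≤ |(k : ℝ)| := by exact_mod_cast Int.one_le_abs hk0
    rw [h2, abs_mul, abs_of_nonneg (by positivity : 0 ≤ √2 / 2)] at hp
    nlinarith
  rw [hk0, Int.cast_zero] at h1
  exact (mul_eq_zero.1 h1).resolve_left rot_ne_zero

theorem half_line_eq (v : ℝ) :
    (1 / 2 : ℂ) + v * rot = rot * (((v + √2 / 4 : ℝ) : ℂ) + (√2 / 4 : ℝ) * I) := by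
  have h2 : ((√2 : ℝ) : ℂ) ^ 2 = 2 := by
    exact_mod_cast Real.sq_sqrt (show (0 : ℝ) ≤ 2 by norm_num)
  rw [rot_eq]; push_cast
  linear_combination (-(1 : ℂ) / 4) * h2 + ((√2 : ℂ) ^ 2 / 8) * I_sq

theorem neg_half_line_eq (v : ℝ) :
    (-(1 / 2) : ℂ) + v * rot = rot * (((v - √2 / 4 : ℝ) : ℂ) + (-(√2 / 4) : ℝ) * I) := by
  have h := half_line_eq (-v)
  push_cast at h ⊢
  linear_combination -h

/-- The difference of the integrals over the lines through `-1/2` and `1/2` is the residue at `0`. -/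
theorem lineInt_sub_lineInt {Q : ℂ → ℂ} (hQ : Differentiable ℂ Q) {C : ℝ}
    (hC : ∀ p : ℂ, |p.im| ≤ 1 → ‖Q (rot * p)‖ ≤ C * Real.exp (-p.re ^ 2)) :
    lineInt Q (-(1 / 2)) - lineInt Q (1 / 2) = Q 0 := by
  have hs2 := Real.sq_sqrt (show (0 : ℝ) ≤ 2 by norm_num)
  have hsp : 0 < √2 := by positivity
  have hs15 : √2 < 1.5 := by nlinarith
  have hs1 : 1.4 < √2 := by nlinarith
  have hπ3 := Real.pi_gt_three
  have hC0 : 0 ≤ C := by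
    have := hC 0 (by simp)
    simpa using (norm_nonneg _).trans this
  -- With `x = rot * p` the lines through `∓1/2` become `Im p = ∓√2/4`. The nonzero integers lie at
  -- `|Im p| ≥ √2/2`, so `p = 0` is the only pole in `|Im p| < 1/2`.
  set ε : ℝ := √2 / 4 with hε
  set F : ℂ → ℂ := fun p => Q (rot * p) / (2 * I * sin (π * (rot * p))) * rot with hF
  set S : ℂ → ℂ := dslope (fun p => sin (π * (rot * p))) 0 with hS
  have hSd : Differentiable ℂ S := by
    rw [← differentiableOn_univ]
    refine (differentiableOn_dslope univ_mem).2 ?_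
    rw [differentiableOn_univ]; fun_prop
  have hS0 : S 0 = π * rot := by
    rw [hS, dslope_same]
    have h1 : HasDerivAt (fun p : ℂ => (π : ℂ) * (rot * p)) (π * (rot * 1)) 0 :=
      ((hasDerivAt_id (0 : ℂ)).const_mul rot).const_mul (π : ℂ)
    have h2 := h1.csin
    simpa using h2.deriv
  have hSp : ∀ p : ℂ, p ≠ 0 → S p = sin (π * (rot * p)) / p := by
    intro p hp
    rw [hS, dslope_of_ne _ hp, slope_def_field]; simp
  have hπ0 : (π : ℂ) ≠ 0 := by exact_mod_cast Real.pi_ne_zero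
  have hSne : ∀ p ∈ {p : ℂ | |p.im| < 1 / 2}, S p ≠ 0 := by
    intro p hp h
    by_cases hp0 : p = 0
    · rw [hp0, hS0] at h
      exact mul_ne_zero hπ0 rot_ne_zero h
    · rw [hSp p hp0, div_eq_zero_iff] at h
      exact hp0 (sin_rot_eq_zero hp (h.resolve_right hp0))
  set φ : ℂ → ℂ := fun p => Q (rot * p) * rot / (2 * I * S p) with hφ
  have hbase : ∀ u τ D : ℝ, 0 < D → |τ| ≤ 1 →
      D ≤ ‖sin (π * (rot * ((u : ℂ) + τ * I)))‖ →
      ‖F (u + τ * I)‖ ≤ C * Real.exp (-u ^ 2) / (2 * D) := by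
    intro u τ D hD hτ hDs
    have h1 := hC (u + τ * I) (by simpa using hτ)
    simp only [add_re, ofReal_re, mul_re, I_re, mul_zero, ofReal_im, I_im, mul_one, sub_self,
      add_zero] at h1
    rw [hF]
    simp only [norm_mul, norm_div, norm_rot, mul_one, Complex.norm_I, Complex.norm_ofNat]
    exact div_le_div₀ (by positivity) h1 (by positivity) (by linarith)
  have hplus : ∀ u : ℝ, rot * ((u : ℂ) + ε * I) = ((0 : ℤ) : ℂ) + 1 / 2 + ((u - ε : ℝ) : ℂ) * rot := by
    intro u
    rw [Int.cast_zero, zero_add, half_line_eq, hε]; push_cast; ring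
  have hminus : ∀ u : ℝ, rot * ((u : ℂ) + (-ε : ℝ) * I) =
      ((-1 : ℤ) : ℂ) + 1 / 2 + ((u + ε : ℝ) : ℂ) * rot := by
    intro u
    have := neg_half_line_eq (u + ε)
    rw [show (((-1 : ℤ) : ℂ)) + 1 / 2 = -(1 / 2) by push_cast; ring, this, hε]; push_cast; ring
  have hline : ∀ τ : ℝ, |τ| ≤ 1 → (∀ u : ℝ, 1 / 2 ≤ ‖sin (π * (rot * ((u : ℂ) + τ * I)))‖) →
      Integrable fun u : ℝ => F (u + τ * I) := by
    intro τ hτ h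
    refine Integrable.mono' (integrable_exp_neg_sq.const_mul C)
      (Continuous.aestronglyMeasurable ?_) (Eventually.of_forall fun u => ?_)
    · have hQc := hQ.continuous
      refine Continuous.mul (Continuous.div (by fun_prop) (by fun_prop) ?_) continuous_const
      intro u hu
      have h1 := h u
      have : sin (π * (rot * ((u : ℂ) + τ * I))) = 0 := by
        simpa [I_ne_zero] using hu
      rw [this, norm_zero] at h1; norm_num at h1
    · have := hbase u τ (1 / 2) (by norm_num) hτ (h u)
      simpa using this
  have hεabs : |ε| ≤ 1 := by rw [abs_le]; constructor <;> linarith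
  have hip := hline ε hεabs (fun u => by rw [hplus]; exact half_le_norm_sin_line 0 _)
  have him := hline (-ε) (by rwa [abs_neg])
    (fun u => by rw [hminus]; exact half_le_norm_sin_line (-1) _)
  have key := integral_strip_sub_eq_residue (F := F) (φ := φ) (ε := ε) (by positivity)
    (V := {p : ℂ | |p.im| < 1 / 2}) (isOpen_lt (by fun_prop) continuous_const)
    (by
      intro z hz
      have := abs_le.2 (show -ε ≤ z.im ∧ z.im ≤ ε from hz)
      show |z.im| < 1 / 2
      linarith)
    (by
      refine DifferentiableOn.div (by fun_prop) (by fun_prop) ?_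
      intro p hp
      exact mul_ne_zero (mul_ne_zero two_ne_zero I_ne_zero) (hSne p hp))
    (by
      intro p hp hp0
      have h1 := hSne p hp
      rw [hSp p hp0] at h1
      have h2 : sin (π * (rot * p)) ≠ 0 := fun h => h1 (by rw [h, zero_div])
      simp only [hF, hφ]
      rw [hSp p hp0]
      field_simp)
    (g := fun x => C * Real.exp (-x ^ 2))
    (by
      have h1 : Tendsto (fun x : ℝ => x ^ 2) atTop atTop := tendsto_pow_atTop two_ne_zero
      simpa using (Real.tendsto_exp_neg_atTop_nhds_zero.comp h1).const_mul C)
    (by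
      intro u τ hu hτ
      have hτ' : |τ| ≤ ε := abs_le.2 hτ
      have hlow : 1 / 2 ≤ ‖sin (π * (rot * ((u : ℂ) + τ * I)))‖ := by
        refine le_trans ?_ ((abs_le_abs_sinh _).trans (abs_sinh_im_le_norm_sin _))
        have him : (π * (rot * ((u : ℂ) + τ * I))).im = π * (√2 / 2) * (τ - u) := by
          simp; ring
        rw [him, abs_mul, abs_of_pos (by positivity)]
        have h1 : 1 / 2 ≤ |τ - u| := by
          have := abs_sub_abs_le_abs_sub u τ
          rw [abs_sub_comm] at this
          linarith
        have h2 : 1 ≤ π * (√2 / 2) := by nlinarith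
        nlinarith
      have := hbase u τ (1 / 2) (by norm_num) (by linarith) hlow
      simpa [sq_abs] using this)
    him hip
  have e1 : lineInt Q (1 / 2) = ∫ u : ℝ, F (u + ε * I) := by
    rw [← integral_add_right_eq_self (fun u : ℝ => F (u + ε * I)) ε]
    unfold lineInt
    congr 1; ext v
    rw [half_line_eq]
  have e2 : lineInt Q (-(1 / 2)) = ∫ u : ℝ, F (u + (-ε : ℝ) * I) := by
    rw [← integral_sub_right_eq_self (fun u : ℝ => F (u + (-ε : ℝ) * I)) ε]
    unfold lineInt
    congr 1; ext v
    rw [neg_half_line_eq]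
  rw [e1, e2, key, hφ]
  simp only [mul_zero]
  rw [hS0]
  have := rot_ne_zero
  field_simp [I_ne_zero]

/-! ### Gaussians on the lines and the Mordell integrals. -/

/-- The Gaussian `e^{-πi a x² + 2πi b x}`. -/
noncomputable def quad (a : ℝ) (b x : ℂ) : ℂ := exp (-(π * I * a * x ^ 2) + 2 * π * I * b * x)

theorem differentiable_quad (a : ℝ) (b : ℂ) : Differentiable ℂ (quad a b) := by
  unfold quad; fun_prop

theorem quad_add (a : ℝ) (b z x : ℂ) : quad a b (z + x) = quad a b z * quad a (b - a * z) x := by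
  unfold quad
  rw [← Complex.exp_add]
  congr 1; ring

/-- For `x = rot * p` the quadratic term is `-πa p²`. As `πa ≥ 2`, one copy of `p.re²` absorbs the
linear term and another remains as decay. -/
theorem exists_norm_quad_le {a : ℝ} (ha : 1 ≤ a) (b : ℂ) :
    ∃ C : ℝ, ∀ p : ℂ, |p.im| ≤ 1 → ‖quad a b (rot * p)‖ ≤ C * Real.exp (-p.re ^ 2) := by
  set M := 2 * π * ‖b‖ with hM
  refine ⟨Real.exp (π * a + M + M ^ 2 / 4), fun p hp => ?_⟩
  have hπ := Real.pi_gt_three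
  have hM0 : 0 ≤ M := by positivity
  unfold quad
  rw [norm_exp, ← Real.exp_add, Real.exp_le_exp]
  have h1 : -(π * I * a * (rot * p) ^ 2) = ((-(π * a) : ℝ) : ℂ) * p ^ 2 := by
    rw [mul_pow, rot_sq]; push_cast
    linear_combination (π * a * p ^ 2) * I_sq
  rw [h1, add_re, re_ofReal_mul]
  have h2 : (p ^ 2).re = p.re ^ 2 - p.im ^ 2 := by
    rw [sq, mul_re]; ring
  have h3 : (2 * π * I * b * (rot * p)).re ≤ M * (|p.re| + 1) := by
    refine (re_le_norm _).trans ?_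
    have h4 : ‖2 * (π : ℂ) * I * b * (rot * p)‖ = M * ‖p‖ := by
      simp only [norm_mul, norm_rot, norm_I, Complex.norm_ofNat, Complex.norm_real, Real.norm_eq_abs,
        abs_of_pos Real.pi_pos, hM]
      ring
    rw [h4]
    have := norm_le_abs_re_add_abs_im p
    gcongr
    linarith
  rw [h2]
  have h5 : p.im ^ 2 ≤ 1 := by rw [← sq_abs]; nlinarith [abs_nonneg p.im]
  have h6 : π * a * p.im ^ 2 ≤ π * a := by nlinarith [mul_pos Real.pi_pos (by linarith : 0 < a)]
  have h7 : 2 * p.re ^ 2 ≤ π * a * p.re ^ 2 := by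
    have : 2 ≤ π * a := by nlinarith
    nlinarith [sq_nonneg p.re]
  have h8 : M * |p.re| ≤ p.re ^ 2 + M ^ 2 / 4 := by
    rw [← sq_abs p.re]; nlinarith [sq_nonneg (|p.re| - M / 2)]
  nlinarith

theorem sin_nat_add (n : ℕ) (x : ℂ) : sin (π * (n + x)) = (-1) ^ n * sin (π * x) := by
  rw [show (π : ℂ) * (n + x) = π * x + n * π by ring]
  exact sin_antiperiodic.add_nat_mul_eq n

theorem lineInt_nat_add (Q : ℂ → ℂ) (n : ℕ) (c : ℂ) :
    lineInt Q (n + c) = (-1) ^ n * lineInt (fun x => Q (n + x)) c := by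
  unfold lineInt
  rw [← integral_const_mul]
  congr 1; ext v
  rw [add_assoc, sin_nat_add]
  have h : ((-1 : ℂ) ^ n)⁻¹ = (-1) ^ n := by rw [← inv_pow]; norm_num
  rw [show 2 * I * ((-1) ^ n * sin (π * (c + v * rot))) =
    (-1) ^ n * (2 * I * sin (π * (c + v * rot))) by ring, ← div_div, div_eq_mul_inv _ ((-1 : ℂ) ^ n),
    h]
  ring

theorem lineInt_const_mul (k : ℂ) (Q : ℂ → ℂ) (c : ℂ) :
    lineInt (fun x => k * Q x) c = k * lineInt Q c := by
  unfold lineInt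
  rw [← integral_const_mul]
  congr 1; ext v; ring

/-- Translation by `n` recentres the Gaussian (`quad_add`) and multiplies the sine by `(-1)^n`,
which reduces the residue at `n` to the one at `0`. -/
theorem lineInt_quad_residue {a : ℝ} (ha : 1 ≤ a) (b : ℂ) (n : ℕ) :
    lineInt (quad a b) (n - 1 / 2) - lineInt (quad a b) (n + 1 / 2) = (-1) ^ n * quad a b n := by
  obtain ⟨C, hC⟩ := exists_norm_quad_le ha (b - a * n)
  have h := lineInt_sub_lineInt (differentiable_quad a (b - a * n)) hC
  rw [sub_eq_add_neg (n : ℂ), lineInt_nat_add, lineInt_nat_add]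
  simp only [quad_add]
  rw [lineInt_const_mul, lineInt_const_mul, ← mul_sub, ← mul_sub, h]
  simp [quad]

theorem exists_norm_quad_line_le {a : ℝ} (ha : 1 ≤ a) (b c : ℂ) :
    ∃ C : ℝ, 0 ≤ C ∧ ∀ v : ℝ, ‖quad a b (c + v * rot)‖ ≤ C * Real.exp (-v ^ 2) := by
  obtain ⟨C, hC⟩ := exists_norm_quad_le ha (b - a * c)
  have hC0 : 0 ≤ C := by
    have := hC 0 (by simp)
    simpa using (norm_nonneg _).trans this
  refine ⟨‖quad a b c‖ * C, by positivity, fun v => ?_⟩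
  rw [quad_add, norm_mul, mul_assoc, mul_comm (v : ℂ)]
  have := hC v (by simp)
  rw [ofReal_re] at this
  gcongr

theorem integrable_quad_line {a : ℝ} (ha : 1 ≤ a) (b c : ℂ) :
    Integrable fun v : ℝ => quad a b (c + v * rot) * rot := by
  obtain ⟨C, -, hC⟩ := exists_norm_quad_line_le ha b c
  have := (differentiable_quad a b).continuous
  refine Integrable.mul_const ?_ _
  exact Integrable.mono' (integrable_exp_neg_sq.const_mul C)
    (Continuous.aestronglyMeasurable (by fun_prop)) (Eventually.of_forall hC)

theorem integrable_quad_div_sin {a : ℝ} (ha : 1 ≤ a) (b : ℂ) (N : ℤ) :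
    Integrable fun v : ℝ => quad a b (N + 1 / 2 + v * rot) /
      (2 * I * sin (π * (N + 1 / 2 + v * rot))) * rot := by
  obtain ⟨C, hC0, hC⟩ := exists_norm_quad_line_le ha b (N + 1 / 2)
  have := (differentiable_quad a b).continuous
  refine Integrable.mul_const ?_ _
  refine Integrable.mono' (integrable_exp_neg_sq.const_mul C)
    (Continuous.aestronglyMeasurable ?_) (Eventually.of_forall fun v => ?_)
  · refine Continuous.div (by fun_prop) (by fun_prop) fun v => ?_
    exact mul_ne_zero (mul_ne_zero two_ne_zero I_ne_zero) (sin_line_ne_zero N v)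
  · rw [norm_div, norm_mul, norm_mul, norm_I, Complex.norm_ofNat, mul_one]
    refine (div_le_self (norm_nonneg _) ?_).trans (hC v)
    linarith [half_le_norm_sin_line N v]

theorem integral_quad_line {a : ℝ} (ha : 0 < a) (b c : ℂ) :
    ∫ v : ℝ, quad a b (c + v * rot) * rot = rot * (1 / a) ^ (1 / 2 : ℂ) * exp (π * I * b ^ 2 / a) := by
  have hπ0 : (π : ℂ) ≠ 0 := by exact_mod_cast Real.pi_ne_zero
  have ha0 : (a : ℂ) ≠ 0 := by exact_mod_cast ha.ne'
  have hb : (-(π * a) : ℂ).re < 0 := by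
    rw [neg_re, ← ofReal_mul, ofReal_re]
    have := mul_pos Real.pi_pos ha
    linarith
  have h := integral_cexp_quadratic hb (rot * (2 * π * I * (b - a * c)))
    (-(π * I * a * c ^ 2) + 2 * π * I * b * c)
  have e : ∀ v : ℝ, quad a b (c + v * rot) = exp (-(π * a) * (v : ℂ) ^ 2 +
      rot * (2 * π * I * (b - a * c)) * v + (-(π * I * a * c ^ 2) + 2 * π * I * b * c)) := by
    intro v
    unfold quad
    congr 1
    linear_combination (-(π * I * a * (v : ℂ) ^ 2)) * rot_sq + π * a * (v : ℂ) ^ 2 * I_sq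
  rw [integral_mul_const]
  simp only [e]
  have e1 : (π : ℂ) / (π * a) = 1 / a := by field_simp
  have e2 : -(π * I * a * c ^ 2) + 2 * π * I * b * c -
      (rot * (2 * π * I * (b - a * c))) ^ 2 / (4 * -(π * a)) = π * I * b ^ 2 / a := by
    rw [mul_pow, rot_sq, show (2 * π * I * (b - a * c)) ^ 2 = -(4 * π ^ 2 * (b - a * c) ^ 2) by
      linear_combination 4 * π ^ 2 * (b - a * c) ^ 2 * I_sq]
    field_simp
    ring
  rw [h, neg_neg, e1, e2]
  ring

theorem exp_neg_sub_exp (x : ℂ) : exp (-(π * I * x)) - exp (π * I * x) = -(2 * I * sin (π * x)) := by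
  rw [show (π : ℂ) * I * x = (π * x) * I by ring, ← neg_mul, exp_mul_I, exp_mul_I, Complex.cos_neg,
    Complex.sin_neg]
  ring

/-- The shift `x ↦ x + 1` for the Gaussian `e^{-πi x² + 2πi b x}`. -/
theorem lineInt_quad_one_shift (b : ℂ) (N : ℤ) :
    lineInt (quad 1 b) (N + 1 / 2 + 1) =
      exp (2 * π * I * b) * (lineInt (quad 1 b) (N + 1 / 2) - rot * exp (π * I * (b - 1 / 2) ^ 2)) := by
  have hJ := integral_quad_line one_pos (b - 1 / 2) (N + 1 / 2)
  simp only [ofReal_one, div_one, one_cpow, mul_one] at hJ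
  rw [← hJ]
  unfold lineInt
  rw [← integral_sub (integrable_quad_div_sin le_rfl b N) (integrable_quad_line le_rfl _ _),
    ← integral_const_mul]
  congr 1; ext v
  have hs := sin_line_ne_zero N v
  set x : ℂ := N + 1 / 2 + v * rot with hx
  rw [show (N : ℂ) + 1 / 2 + 1 + v * rot = x + 1 by rw [hx]; ring,
    show (π : ℂ) * (x + 1) = π * x + π by ring, Complex.sin_add_pi]
  -- The shift produces `e^{-πi x} = e^{πi x} - 2i sin πx`: the first part restores `quad 1 b x`,
  -- the second cancels the sine and leaves a plain Gaussian.
  have h1 : quad 1 b (x + 1) = -exp (2 * π * I * b) * quad 1 (b - 1 / 2) x * exp (-(π * I * x)) := by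
    rw [show -exp (2 * π * I * b) * quad 1 (b - 1 / 2) x * exp (-(π * I * x)) =
      exp (-(π * I)) * (exp (2 * π * I * b) * quad 1 (b - 1 / 2) x * exp (-(π * I * x))) by
        rw [exp_neg_pi_mul_I]; ring, quad, quad, ← Complex.exp_add, ← Complex.exp_add,
      ← Complex.exp_add]
    congr 1; push_cast; ring
  have h2 : quad 1 b x = quad 1 (b - 1 / 2) x * exp (π * I * x) := by
    rw [quad, quad, ← Complex.exp_add]; congr 1; ring
  rw [h1, h2]
  have h3 := exp_neg_sub_exp x
  generalize quad 1 (b - 1 / 2) x = q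
  field_simp [I_ne_zero]
  linear_combination (q * rot) * h3

/-- The shift `x ↦ x + 1` for the Gaussian `e^{-2πi x² + 2πi b x}`. -/
theorem lineInt_quad_two_shift (b : ℂ) (N : ℤ) :
    lineInt (quad 2 b) (N + 1 / 2 + 1) =
      -exp (2 * π * I * b) * (lineInt (quad 2 b) (N + 1 / 2) -
        rot * (1 / 2) ^ (1 / 2 : ℂ) *
          (exp (π * I * (b - 1 / 2) ^ 2 / 2) + exp (π * I * (b - 3 / 2) ^ 2 / 2))) := by
  have hJ1 := integral_quad_line two_pos (b - 1 / 2) (N + 1 / 2)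
  have hJ3 := integral_quad_line two_pos (b - 3 / 2) (N + 1 / 2)
  simp only [ofReal_ofNat] at hJ1 hJ3
  have hadd : Integrable fun v : ℝ => quad 2 (b - 1 / 2) (N + 1 / 2 + v * rot) * rot +
      quad 2 (b - 3 / 2) (N + 1 / 2 + v * rot) * rot :=
    (integrable_quad_line one_le_two _ _).add (integrable_quad_line one_le_two _ _)
  rw [mul_add, ← hJ1, ← hJ3]
  unfold lineInt
  rw [← integral_add (integrable_quad_line one_le_two _ _) (integrable_quad_line one_le_two _ _),
    ← integral_sub (integrable_quad_div_sin one_le_two b N) hadd,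
    ← integral_const_mul]
  congr 1; ext v
  have hs := sin_line_ne_zero N v
  set x : ℂ := N + 1 / 2 + v * rot with hx
  rw [show (N : ℂ) + 1 / 2 + 1 + v * rot = x + 1 by rw [hx]; ring,
    show (π : ℂ) * (x + 1) = π * x + π by ring, Complex.sin_add_pi]
  -- Here `e^{-2πi x} = e^{2πi x} - 2i sin πx (e^{πi x} + e^{-πi x})`, hence two plain Gaussians.
  have h1 : quad 2 b (x + 1) = exp (2 * π * I * b) * quad 2 (b - 1) x * exp (-(π * I * x)) ^ 2 := by
    rw [quad, quad, ← Complex.exp_nat_mul, ← Complex.exp_add, ← Complex.exp_add]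
    refine Complex.exp_eq_exp_iff_exists_int.2 ⟨-1, ?_⟩
    push_cast; ring
  have h2 : quad 2 b x = quad 2 (b - 1) x * exp (π * I * x) ^ 2 := by
    rw [quad, quad, ← Complex.exp_nat_mul, ← Complex.exp_add]; congr 1; push_cast; ring
  have h4 : quad 2 (b - 1 / 2) x = quad 2 (b - 1) x * exp (π * I * x) := by
    rw [quad, quad, ← Complex.exp_add]; congr 1; ring
  have h5 : quad 2 (b - 3 / 2) x = quad 2 (b - 1) x * exp (-(π * I * x)) := by
    rw [quad, quad, ← Complex.exp_add]; congr 1; ring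
  rw [h1, h2, h4, h5]
  have h3 := exp_neg_sub_exp x
  generalize quad 2 (b - 1) x = q
  field_simp [I_ne_zero]
  linear_combination (-q * rot * (exp (-(π * I * x)) + exp (π * I * x))) * h3

theorem neg_one_pow_mul_exp_sq (n : ℕ) : (-1 : ℂ) ^ n * exp (-(π * I * (n : ℂ) ^ 2)) = 1 := by
  rw [← exp_pi_mul_I, ← Complex.exp_nat_mul, ← Complex.exp_add, Complex.exp_eq_one_iff]
  obtain ⟨k, hk⟩ := Int.even_mul_pred_self (n : ℤ)
  refine ⟨-k, ?_⟩
  have hk' : (n : ℂ) * (n - 1) = k + k := by exact_mod_cast congrArg (Int.cast : ℤ → ℂ) hk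
  push_cast
  linear_combination (-(π * I)) * hk'

theorem norm_exp_two_pi_lt_one {y : ℂ} (hy : 0 < y.im) : ‖exp (2 * π * I * y)‖ < 1 := by
  rw [norm_exp, Real.exp_lt_one_iff]
  have : (2 * π * I * y).re = -(2 * π * y.im) := by simp
  rw [this]
  have := mul_pos Real.two_pi_pos hy
  linarith

theorem hasSum_exp_tail {y : ℂ} (hy : 0 < y.im) (N : ℕ) :
    HasSum (fun k : ℕ => exp (2 * π * I * ((N + 1 + k : ℕ) : ℂ) * y))
      (exp (2 * π * I * (N + 1) * y) / (1 - exp (2 * π * I * y))) := by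
  have h := (hasSum_geometric_of_norm_lt_one (norm_exp_two_pi_lt_one hy)).mul_left
    (exp (2 * π * I * (N + 1) * y))
  rw [← div_eq_mul_inv] at h
  refine h.congr_fun fun k => ?_
  rw [← Complex.exp_nat_mul, ← Complex.exp_add]
  congr 1; push_cast; ring

/-- Mordell's evaluation of `∫ e^{-πi x² + 2πi x y} / (2i sin πx) dx`. -/
theorem exp_div_sin_eq_lineInt_sub {y : ℂ} (hy : 0 < y.im) (N : ℕ) :
    exp (π * I * y ^ 2) / (2 * I * sin (π * y)) =
      lineInt (quad 1 y) (N + 1 / 2) - ∑' k : ℕ, exp (2 * π * I * ((N + 1 + k : ℕ) : ℂ) * y) := by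
  rw [(hasSum_exp_tail hy N).tsum_eq]
  -- The residue at `N + 1` and the shift by `1` both relate the lines through `N + 1/2` and `N +
  -- 3/2`; eliminating the second leaves a linear equation for the first.
  have h1 := lineInt_quad_residue le_rfl y (N + 1)
  have h2 := lineInt_quad_one_shift y N
  have hq : (-1 : ℂ) ^ (N + 1) * quad 1 y ((N + 1 : ℕ) : ℂ) = exp (2 * π * I * (N + 1) * y) := by
    rw [quad, Complex.exp_add, ← mul_assoc, ofReal_one, mul_one, neg_one_pow_mul_exp_sq, one_mul]
    congr 1; push_cast; ring
  rw [hq] at h1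
  rw [Int.cast_natCast] at h2
  rw [show ((N + 1 : ℕ) : ℂ) - 1 / 2 = N + 1 / 2 by push_cast; ring,
    show ((N + 1 : ℕ) : ℂ) + 1 / 2 = N + 1 / 2 + 1 by push_cast; ring, h2] at h1
  have hJ : exp (2 * π * I * y) * (rot * exp (π * I * (y - 1 / 2) ^ 2)) =
      exp (π * I * y ^ 2) * exp (π * I * y) := by
    rw [rot, ← Complex.exp_add, ← Complex.exp_add, ← Complex.exp_add]
    congr 1; ring
  have hne : 1 - exp (2 * π * I * y) ≠ 0 := by
    intro h
    have := norm_exp_two_pi_lt_one hy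
    rw [← sub_eq_zero.1 h, norm_one] at this
    exact lt_irrefl _ this
  have hfac : 1 - exp (2 * π * I * y) = -(2 * I * sin (π * y)) * exp (π * I * y) := by
    rw [← exp_neg_sub_exp, sub_mul, ← Complex.exp_add, ← Complex.exp_add, neg_add_cancel,
      Complex.exp_zero]
    congr 2; ring
  have hs : 2 * I * sin (π * y) ≠ 0 := by
    intro h; rw [hfac, h] at hne; simp at hne
  rw [eq_sub_iff_add_eq, div_add_div _ _ hs hne, div_eq_iff (mul_ne_zero hs hne)]
  linear_combination (-(2 * I * sin (π * y))) * h1 + (2 * I * sin (π * y)) * hJ +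
    exp (π * I * y ^ 2) * hfac

theorem half_cpow_half : (1 / 2 : ℂ) ^ (1 / 2 : ℂ) = ((√2 : ℝ) : ℂ) / 2 := by
  have h : ((1 / 2 : ℝ) ^ (1 / 2 : ℝ) : ℝ) = √2 / 2 := by
    rw [← Real.sqrt_eq_rpow, Real.sqrt_eq_iff_mul_self_eq (by norm_num) (by positivity)]
    nlinarith [Real.sq_sqrt (show (0 : ℝ) ≤ 2 by norm_num)]
  have h2 := Complex.ofReal_cpow (show (0 : ℝ) ≤ 1 / 2 by norm_num) (1 / 2)
  rw [h] at h2
  push_cast at h2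
  exact h2.symm

/-! ### The Gaussian at the saddle point and the main term. -/

/-- The Gaussian `e^{-2πi (x - η)²}` that approximates the integrand near the saddle point. -/
noncomputable def saddleGauss (η x : ℂ) : ℂ := exp (-(2 * π * I * (x - η) ^ 2))

theorem saddleGauss_eq (η x : ℂ) :
    saddleGauss η x = exp (-(2 * π * I * η ^ 2)) * quad 2 (2 * η) x := by
  rw [saddleGauss, quad, ← Complex.exp_add]; congr 1; push_cast; ring

/-- Since `e^{-2πi n²} = 1`, the Gaussian is geometric along the integers. -/
theorem saddleGauss_nat (η : ℂ) (n : ℕ) :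
    saddleGauss η n = exp (-(2 * π * I * η ^ 2)) * exp (4 * π * I * η) ^ n := by
  rw [saddleGauss, ← Complex.exp_nat_mul, ← Complex.exp_add]
  refine Complex.exp_eq_exp_iff_exists_int.2 ⟨-(n ^ 2 : ℤ), ?_⟩
  push_cast; ring

theorem norm_exp_four_pi_lt_one {η : ℂ} (hη : 0 < η.im) : ‖exp (4 * π * I * η)‖ < 1 := by
  rw [show 4 * π * I * η = 2 * π * I * (2 * η) by ring]
  exact norm_exp_two_pi_lt_one (by simpa using hη)

theorem hasSum_saddleGauss {η : ℂ} (hη : 0 < η.im) (N : ℕ) :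
    HasSum (fun k : ℕ => (-1) ^ (N + 1 + k) * saddleGauss η ((N + 1 + k : ℕ) : ℂ))
      ((-1) ^ (N + 1) * saddleGauss η ((N + 1 : ℕ) : ℂ) / (1 + exp (4 * π * I * η))) := by
  have h := (hasSum_geometric_of_norm_lt_one (ξ := -exp (4 * π * I * η))
    (by rw [norm_neg]; exact norm_exp_four_pi_lt_one hη)).mul_left
    ((-1) ^ (N + 1) * saddleGauss η ((N + 1 : ℕ) : ℂ))
  rw [← div_eq_mul_inv, sub_neg_eq_add] at h
  refine h.congr_fun fun k => ?_
  rw [saddleGauss_nat, saddleGauss_nat, neg_pow (exp (4 * π * I * η)) k]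
  ring

theorem one_add_exp_ne_zero {η : ℂ} (hη : 0 < η.im) : 1 + exp (4 * π * I * η) ≠ 0 := by
  intro h
  have := norm_exp_four_pi_lt_one hη
  rw [← neg_eq_of_add_eq_zero_right h, norm_neg, norm_one] at this
  exact lt_irrefl _ this

/-- The source of the main term. Both pieces have the denominator `1 + e^{4πiη} = 2 e^{2πiη} cos
2πη`. The residue at `N + 1` cancels the first term of the tail, and the two Gaussians from the
shift combine to `sin πη`. -/
theorem saddleGauss_sum_sub_lineInt {η : ℂ} (hη : 0 < η.im) (N : ℕ) :
    (∑' k : ℕ, (-1) ^ (N + 1 + k) * saddleGauss η ((N + 1 + k : ℕ) : ℂ)) -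
      lineInt (saddleGauss η) (N + 1 / 2) =
    -((√2 : ℂ) * exp (3 * π * I / 8) * sin (π * η) / (2 * cos (2 * π * η))) := by
  rw [(hasSum_saddleGauss hη N).tsum_eq]
  have h1 := lineInt_quad_residue one_le_two (2 * η) (N + 1)
  have h2 := lineInt_quad_two_shift (2 * η) N
  rw [Int.cast_natCast] at h2
  rw [show ((N + 1 : ℕ) : ℂ) - 1 / 2 = N + 1 / 2 by push_cast; ring,
    show ((N + 1 : ℕ) : ℂ) + 1 / 2 = N + 1 / 2 + 1 by push_cast; ring, h2, half_cpow_half,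
    show 2 * π * I * (2 * η) = 4 * π * I * η by ring] at h1
  have hG : lineInt (saddleGauss η) (N + 1 / 2) =
      exp (-(2 * π * I * η ^ 2)) * lineInt (quad 2 (2 * η)) (N + 1 / 2) := by
    rw [← lineInt_const_mul]; congr 1; ext x; exact saddleGauss_eq η x
  have hQ := saddleGauss_eq η ((N + 1 : ℕ) : ℂ)
  have hne := one_add_exp_ne_zero hη
  have hcos : 1 + exp (4 * π * I * η) = exp (2 * π * I * η) * (2 * cos (2 * π * η)) := by
    rw [Complex.cos, mul_div_cancel₀ _ (two_ne_zero' ℂ), mul_add, ← Complex.exp_add,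
      ← Complex.exp_add, add_comm, show 2 * π * I * η + -(2 * π * η) * I = 0 by ring,
      Complex.exp_zero]
    congr 2; ring
  have hcne : 2 * cos (2 * π * η) ≠ 0 := by
    intro h; rw [h, mul_zero] at hcos; exact hne hcos
  have hJ : exp (-(2 * π * I * η ^ 2)) * (rot * (exp (π * I * (2 * η - 1 / 2) ^ 2 / 2) +
      exp (π * I * (2 * η - 3 / 2) ^ 2 / 2))) =
      exp (-(2 * π * I * η)) * exp (3 * π * I / 8) * (2 * sin (π * η)) := by
    have hsin : 2 * sin (π * η) = exp (π * I * η + -π / 2 * I) - exp (-(π * I * η) + -π / 2 * I) := by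
      rw [Complex.exp_add, Complex.exp_add, exp_neg_pi_div_two_mul_I, Complex.sin,
        show -((π : ℂ) * η) * I = -(π * I * η) by ring, show (π : ℂ) * η * I = π * I * η by ring]
      ring
    have hneg : exp (π * I * (2 * η - 3 / 2) ^ 2 / 2) =
        -exp (π * I * (2 * η ^ 2 - 3 * η + 1 / 8)) := by
      rw [show (π : ℂ) * I * (2 * η - 3 / 2) ^ 2 / 2 =
        π * I * (2 * η ^ 2 - 3 * η + 1 / 8) + π * I by ring, Complex.exp_add, exp_pi_mul_I]
      ring
    rw [hneg, hsin, rot, ← sub_eq_add_neg, mul_sub, mul_sub, mul_sub]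
    simp only [← Complex.exp_add]
    congr 2 <;> ring
  have hE : exp (4 * π * I * η) * exp (-(2 * π * I * η)) = exp (2 * π * I * η) := by
    rw [← Complex.exp_add]; congr 1; ring
  have key : (-1) ^ (N + 1) * saddleGauss η ((N + 1 : ℕ) : ℂ) -
      (1 + exp (4 * π * I * η)) * lineInt (saddleGauss η) (N + 1 / 2) =
      -((√2 : ℂ) * exp (3 * π * I / 8) * sin (π * η)) * exp (2 * π * I * η) := by
    rw [hG, hQ]
    linear_combination (-exp (-(2 * π * I * η ^ 2))) * h1 -
      exp (4 * π * I * η) * ((√2 : ℂ) / 2) * hJ -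
      ((√2 : ℂ) * exp (3 * π * I / 8) * sin (π * η)) * hE
  rw [div_sub' hne, key, hcos]
  field_simp [Complex.exp_ne_zero]

/-! ### The Gamma integral with complex rate. -/

theorem integrableOn_rpow_mul_exp_neg {q m : ℝ} (hq : -1 < q) (hm : 0 < m) :
    IntegrableOn (fun t : ℝ => t ^ q * Real.exp (-(m * t))) (Ioi 0) := by
  have h := integrableOn_rpow_mul_exp_neg_mul_rpow hq one_pos hm
  refine h.congr_fun (fun t _ => ?_) measurableSet_Ioi
  simp

theorem norm_cpow_mul_exp_neg {a r : ℂ} {t : ℝ} (ht : 0 < t) :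
    ‖(t : ℂ) ^ a * exp (-(r * t))‖ = t ^ a.re * Real.exp (-(r.re * t)) := by
  rw [norm_mul, norm_cpow_eq_rpow_re_of_pos ht, norm_exp]
  congr 2; simp

theorem aestronglyMeasurable_cpow_mul_exp_neg (a r : ℂ) :
    AEStronglyMeasurable (fun t : ℝ => (t : ℂ) ^ a * exp (-(r * t))) (volume.restrict (Ioi 0)) := by
  refine ContinuousOn.aestronglyMeasurable (fun t ht => ?_) measurableSet_Ioi
  refine ContinuousAt.continuousWithinAt (ContinuousAt.mul ?_ (by fun_prop))
  exact continuousAt_ofReal_cpow_const _ _ (Or.inr (ne_of_gt ht))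

theorem integrableOn_cpow_mul_exp_neg {a r : ℂ} (ha : -1 < a.re) (hr : 0 < r.re) :
    IntegrableOn (fun t : ℝ => (t : ℂ) ^ a * exp (-(r * t))) (Ioi 0) := by
  refine Integrable.mono' (integrableOn_rpow_mul_exp_neg ha hr)
    (aestronglyMeasurable_cpow_mul_exp_neg a r) ?_
  filter_upwards [ae_restrict_mem measurableSet_Ioi] with t ht
  rw [norm_cpow_mul_exp_neg ht]

theorem differentiableAt_laplace_cpow {a r : ℂ} (ha : -1 < a.re) (hr : 0 < r.re) :
    DifferentiableAt ℂ (fun r : ℂ => ∫ t in Ioi (0 : ℝ), (t : ℂ) ^ a * exp (-(r * t))) r := by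
  have hnear : {z : ℂ | r.re / 2 < z.re} ∈ 𝓝 r :=
    (isOpen_lt continuous_const continuous_re).mem_nhds (by simpa using by linarith)
  refine (hasDerivAt_integral_of_dominated_loc_of_deriv_le (μ := volume.restrict (Ioi (0 : ℝ)))
    (F := fun (r : ℂ) (t : ℝ) => (t : ℂ) ^ a * exp (-(r * t)))
    (F' := fun (r : ℂ) (t : ℝ) => (t : ℂ) ^ a * (exp (-(r * t)) * -(t : ℂ)))
    (bound := fun t => t ^ (a.re + 1) * Real.exp (-(r.re / 2 * t)))
    hnear ?_ ?_ ?_ ?_ ?_ ?_).2.differentiableAt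
  · exact Eventually.of_forall fun z => aestronglyMeasurable_cpow_mul_exp_neg a z
  · exact integrableOn_cpow_mul_exp_neg ha hr
  · have := (aestronglyMeasurable_cpow_mul_exp_neg a r).mul
      (Continuous.aestronglyMeasurable (show Continuous fun t : ℝ => -(t : ℂ) by fun_prop))
    refine this.congr (Eventually.of_forall fun t => ?_)
    simp [mul_assoc]
  · filter_upwards [ae_restrict_mem measurableSet_Ioi] with t ht z hz
    have ht' : (0 : ℝ) < t := ht
    rw [← mul_assoc, norm_mul, norm_cpow_mul_exp_neg ht', norm_neg, norm_real, Real.norm_eq_abs,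
      abs_of_pos ht', Real.rpow_add_one ht'.ne']
    have hz' : r.re / 2 < z.re := hz
    calc t ^ a.re * Real.exp (-(z.re * t)) * t = t ^ a.re * t * Real.exp (-(z.re * t)) := by ring
      _ ≤ _ := by gcongr
  · exact integrableOn_rpow_mul_exp_neg (by linarith) (by linarith)
  · refine Eventually.of_forall fun t z _ => ?_
    have h1 : HasDerivAt (fun z : ℂ => -(z * t)) (-(1 * (t : ℂ))) z :=
      ((hasDerivAt_id z).mul_const (t : ℂ)).neg
    simpa using h1.cexp.const_mul ((t : ℂ) ^ a)

/-- The Gamma integral `∫ t^{a-1} e^{-rt} dt` for complex `r`. -/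
theorem integral_cpow_mul_exp_neg_mul_Ioi_of_re_pos {a r : ℂ} (ha : 0 < a.re) (hr : 0 < r.re) :
    ∫ t in Ioi (0 : ℝ), (t : ℂ) ^ (a - 1) * exp (-(r * t)) = (1 / r) ^ a * Gamma a := by
  set U : Set ℂ := {z | 0 < z.re} with hU
  have hUo : IsOpen U := isOpen_lt continuous_const continuous_re
  have hUc : Convex ℝ U := convex_halfSpace_re_gt 0
  have hf : AnalyticOnNhd ℂ
      (fun r : ℂ => ∫ t in Ioi (0 : ℝ), (t : ℂ) ^ (a - 1) * exp (-(r * t))) U :=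
    DifferentiableOn.analyticOnNhd (fun z hz =>
      (differentiableAt_laplace_cpow (by simpa using ha) hz).differentiableWithinAt) hUo
  have hg : AnalyticOnNhd ℂ (fun r : ℂ => (1 / r) ^ a * Gamma a) U := by
    refine DifferentiableOn.analyticOnNhd (fun z hz => DifferentiableAt.differentiableWithinAt ?_) hUo
    have hz' : 0 < z.re := hz
    have hz0 : z ≠ 0 := fun h => by rw [h] at hz'; simp at hz'
    refine DifferentiableAt.mul_const ?_ _
    refine DifferentiableAt.cpow_const ?_ ?_
    · exact (differentiableAt_const _).div differentiableAt_id hz0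
    · left
      rw [one_div, inv_re]
      exact div_pos hz' (normSq_pos.2 hz0)
  -- Identity theorem: both sides are holomorphic in the right half-plane and agree at positive
  -- reals, which accumulate at `1`.
  have hfreq : ∃ᶠ z in 𝓝[≠] (1 : ℂ),
      (fun r : ℂ => ∫ t in Ioi (0 : ℝ), (t : ℂ) ^ (a - 1) * exp (-(r * t))) z =
        (fun r : ℂ => (1 / r) ^ a * Gamma a) z := by
    have ht : Tendsto (fun x : ℝ => (x : ℂ)) (𝓝[≠] 1) (𝓝[≠] 1) := by
      refine tendsto_nhdsWithin_iff.2 ⟨?_, ?_⟩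
      · exact (by simpa using (continuous_ofReal.tendsto (1 : ℝ)) :
          Tendsto (fun x : ℝ => (x : ℂ)) (𝓝 1) (𝓝 1)).mono_left nhdsWithin_le_nhds
      · filter_upwards [self_mem_nhdsWithin] with x hx h
        exact hx (ofReal_eq_one.1 h)
    refine ht.frequently (Eventually.frequently ?_)
    have : ∀ᶠ x : ℝ in 𝓝[≠] 1, 0 < x :=
      (lt_mem_nhds one_pos).filter_mono nhdsWithin_le_nhds
    filter_upwards [this] with x hx
    exact integral_cpow_mul_exp_neg_mul_Ioi ha hx
  exact hf.eqOn_of_preconnected_of_frequently_eq hg hUc.isPreconnected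
    (by simp [hU] : (1 : ℂ) ∈ U) hfreq hr

theorem integrable_of_le_exp_neg_sq {f : ℝ → ℂ} (hf : Continuous f) {C : ℝ}
    (h : ∀ u, 1 ≤ |u| → ‖f u‖ ≤ C * Real.exp (-u ^ 2)) : Integrable f := by
  obtain ⟨M, hM⟩ := (isCompact_Icc (a := (-1 : ℝ)) (b := 1)).exists_bound_of_continuousOn
    hf.continuousOn
  refine Integrable.mono' (integrable_exp_neg_sq.const_mul (|C| + |M| * Real.exp 1))
    hf.aestronglyMeasurable (Eventually.of_forall fun u => ?_)
  rcases le_total 1 |u| with hu | hu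
  · refine (h u hu).trans ?_
    gcongr
    have := le_abs_self C
    have : 0 ≤ |M| * Real.exp 1 := by positivity
    linarith
  · have h1 : ‖f u‖ ≤ |M| := (hM u (abs_le.1 hu)).trans (le_abs_self M)
    have h2 : 1 ≤ Real.exp 1 * Real.exp (-u ^ 2) := by
      rw [← Real.exp_add]
      apply Real.one_le_exp
      have : u ^ 2 ≤ 1 := by rw [← sq_abs]; nlinarith [abs_nonneg u]
      linarith
    calc ‖f u‖ ≤ |M| * 1 := by linarith
      _ ≤ |M| * (Real.exp 1 * Real.exp (-u ^ 2)) := by gcongr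
      _ ≤ (|C| + |M| * Real.exp 1) * Real.exp (-u ^ 2) := by
        have : 0 ≤ |C| * Real.exp (-u ^ 2) := by positivity
        linarith

/-! ### Moving the path of `auxR` to the origin. -/

/-- The direction `e^{-3πi/4}` of the path of integration of `auxR`. -/
noncomputable def dir : ℂ := exp (-(3 * π * I / 4))

theorem dir_eq : dir = -((√2 / 2 : ℝ) : ℂ) - (√2 / 2 : ℝ) * I := by
  have h : dir = rot * exp (-(π / 2 * I)) := by
    rw [dir, rot, ← Complex.exp_add]; congr 1; ring
  rw [h, Complex.exp_neg, exp_pi_div_two_mul_I, inv_I, rot_eq]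
  linear_combination ((√2 / 2 : ℝ) : ℂ) * I_sq

theorem dir_sq : dir ^ 2 = I := by
  have h2 : ((√2 : ℝ) : ℂ) ^ 2 = 2 := by
    exact_mod_cast Real.sq_sqrt (show (0 : ℝ) ≤ 2 by norm_num)
  rw [dir_eq]; push_cast
  linear_combination (I / 2 + I ^ 2 / 4 + 1 / 4 : ℂ) * h2 + (1 / 2 : ℂ) * I_sq

theorem dir_ne_zero : dir ≠ 0 := exp_ne_zero _

theorem dir_mul_re (p : ℂ) : (dir * p).re = -(√2 / 2) * (p.re - p.im) := by
  rw [dir_eq]; simp; ring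

theorem dir_mul_im (p : ℂ) : (dir * p).im = -(√2 / 2) * (p.re + p.im) := by
  rw [dir_eq]; simp; ring

@[simp] theorem norm_dir : ‖dir‖ = 1 := by
  rw [dir, show -(3 * (π : ℂ) * I / 4) = ((-(3 * π / 4) : ℝ) : ℂ) * I by push_cast; ring]
  exact norm_exp_ofReal_mul_I _

theorem exp_sub_exp_neg (x : ℂ) : exp (π * I * x) - exp (-(π * I * x)) = 2 * I * sin (π * x) := by
  linear_combination -exp_neg_sub_exp x

theorem sin_dir_ne_zero {p : ℂ} (h0 : 0 ≤ p.im) (h1 : p.im ≤ √2 / 4) (hp : p ≠ 0) :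
    2 * I * sin (π * (dir * p)) ≠ 0 := by
  refine mul_ne_zero (mul_ne_zero two_ne_zero I_ne_zero) fun h => ?_
  have hπ : (π : ℂ) ≠ 0 := by exact_mod_cast Real.pi_ne_zero
  obtain ⟨k, hk⟩ := Complex.sin_eq_zero_iff.1 h
  have h2 : dir * p = k := mul_left_cancel₀ hπ (by rw [hk]; ring)
  have hre := dir_mul_re p
  have him := dir_mul_im p
  rw [h2] at hre him
  simp only [intCast_re, intCast_im] at hre him
  have hs := Real.sq_sqrt (show (0 : ℝ) ≤ 2 by norm_num)
  have hsp : 0 < √2 := by positivity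
  have hsum : p.re + p.im = 0 := by
    have : √2 / 2 * (p.re + p.im) = 0 := by linarith
    exact (mul_eq_zero.1 this).resolve_left (by positivity)
  have hk2 : (k : ℝ) = √2 * p.im := by rw [hre, show p.re = -p.im by linarith]; ring
  have hk3 : (k : ℝ) < 1 := by rw [hk2]; nlinarith
  have hk4 : (0 : ℝ) ≤ k := by rw [hk2]; positivity
  have hk0 : k = 0 := by
    have a1 : k < 1 := by exact_mod_cast hk3
    have a2 : 0 ≤ k := by exact_mod_cast hk4
    omega
  rw [hk0, Int.cast_zero] at h2
  exact hp ((mul_eq_zero.1 h2).resolve_left dir_ne_zero)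

theorem kernel_eq (s x : ℂ) :
    kernel s x = x ^ (-s) * exp (π * I * x ^ 2) / (2 * I * sin (π * x)) := by
  rw [kernel, exp_sub_exp_neg]

/-- The delicate point is `x = 0`, where the sine vanishes. Dividing it by `x` turns the power into
`x^{-s-1}`, which is continuous at `0` because `Re(-s-1) > 0`. In this strip `dir * p` can be real
only if it is nonnegative, so the cut is never crossed. -/
theorem continuousOn_kernel_dir {s : ℂ} (hs : s.re < -1) :
    ContinuousOn (fun p => kernel s (dir * p)) {p | p.im ∈ Icc 0 (√2 / 4)} := by
  set S : ℂ → ℂ := dslope (fun x => 2 * I * sin (π * x)) 0 with hS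
  have hSd : Differentiable ℂ S := by
    rw [← differentiableOn_univ]
    refine (differentiableOn_dslope univ_mem).2 ?_
    rw [differentiableOn_univ]; fun_prop
  have hS0 : S 0 ≠ 0 := by
    rw [hS, dslope_same]
    have h1 : HasDerivAt (fun p : ℂ => (π : ℂ) * p) (π * 1) 0 :=
      (hasDerivAt_id (0 : ℂ)).const_mul (π : ℂ)
    have h2 := h1.csin.const_mul (2 * I)
    rw [h2.deriv]
    simp [Real.pi_ne_zero]
  have hSx : ∀ x : ℂ, x ≠ 0 → S x = 2 * I * sin (π * x) / x := by
    intro x hx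
    rw [hS, dslope_of_ne _ hx, slope_def_field]; simp
  have heq : ∀ x : ℂ, kernel s x = x ^ (-s - 1) * exp (π * I * x ^ 2) / S x := by
    intro x
    rw [kernel_eq]
    -- At `0` both sides are `0`: both powers vanish there.
    by_cases hx : x = 0
    · have h1 : -s ≠ 0 := fun h => by
        have := congrArg re h; simp at this; linarith
      have h2 : -s - 1 ≠ 0 := fun h => by
        have := congrArg re h; simp at this; linarith
      rw [hx, zero_cpow h1, zero_cpow h2]; simp
    · rw [hSx x hx, cpow_sub _ _ hx, cpow_one]
      field_simp
  simp only [heq]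
  intro p hp
  refine ContinuousAt.continuousWithinAt ?_
  have hp1 : 0 ≤ p.im := hp.1
  have hre := dir_mul_re p
  have him := dir_mul_im p
  have hsp : 0 < √2 := by positivity
  refine ContinuousAt.div (ContinuousAt.mul ?_ (by fun_prop)) ?_ ?_
  · refine ContinuousAt.comp (f := fun p => dir * p) (g := fun x : ℂ => x ^ (-s - 1)) ?_ (by fun_prop)
    refine continuousAt_cpow_const_of_re_pos ?_ (by simp; linarith)
    by_cases h : (dir * p).im = 0
    · left
      rw [him] at h
      have : p.re + p.im = 0 := (mul_eq_zero.1 h).resolve_left (by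
        have : 0 < √2 / 2 := by positivity
        linarith)
      rw [hre, show p.re = -p.im by linarith]
      nlinarith
    · exact Or.inr h
  · exact (hSd.continuous.continuousAt).comp (by fun_prop)
  · by_cases h0 : p = 0
    · rw [h0, mul_zero]; exact hS0
    · rw [hSx _ (mul_ne_zero dir_ne_zero h0)]
      exact div_ne_zero (sin_dir_ne_zero hp.1 hp.2 h0) (mul_ne_zero dir_ne_zero h0)

theorem differentiableOn_kernel_dir (s : ℂ) :
    DifferentiableOn ℂ (fun p => kernel s (dir * p)) {p | p.im ∈ Ioo 0 (√2 / 4)} := by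
  simp only [kernel_eq]
  intro p hp
  have hp1 : 0 < p.im := hp.1
  refine DifferentiableAt.differentiableWithinAt ?_
  have hp0 : p ≠ 0 := fun h => by rw [h] at hp1; simp at hp1
  refine DifferentiableAt.div (DifferentiableAt.mul ?_ (by fun_prop)) (by fun_prop)
    (sin_dir_ne_zero hp.1.le hp.2.le hp0)
  refine DifferentiableAt.cpow_const (by fun_prop) ?_
  have hsp : 0 < √2 := by positivity
  by_cases h : (dir * p).im = 0
  · left
    rw [dir_mul_im] at h
    have : p.re + p.im = 0 := (mul_eq_zero.1 h).resolve_left (by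
      have : 0 < √2 / 2 := by positivity
      linarith)
    rw [dir_mul_re, show p.re = -p.im by linarith]
    nlinarith
  · exact Or.inr h

theorem exists_norm_kernel_dir_le (s : ℂ) :
    ∃ C : ℝ, ∀ u τ : ℝ, 1 ≤ |u| → τ ∈ Icc 0 (√2 / 4) →
      ‖kernel s (dir * (u + τ * I))‖ ≤ C * Real.exp (-u ^ 2) := by
  obtain ⟨k, hk⟩ := exists_nat_ge (-s.re)
  refine ⟨Real.exp (π * |s.im|) * (k.factorial * Real.exp 1) * Real.exp π, fun u τ hu hτ => ?_⟩
  have hs2 := Real.sq_sqrt (show (0 : ℝ) ≤ 2 by norm_num)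
  have hsp : 0 < √2 := by positivity
  have hs15 : √2 < 1.5 := by nlinarith
  have hs1 : 1.4 < √2 := by nlinarith
  have hπ3 := Real.pi_gt_three
  obtain ⟨hτ0, hτ1⟩ := hτ
  set p : ℂ := u + τ * I with hp
  have hpre : p.re = u := by simp [hp]
  have hpim : p.im = τ := by simp [hp]
  have hpn1 : 1 ≤ ‖p‖ := hu.trans (by rw [← hpre]; exact abs_re_le_norm p)
  have hpn2 : ‖p‖ ≤ 2 * |u| := by
    have := norm_le_abs_re_add_abs_im p
    rw [hpre, hpim, abs_of_nonneg hτ0] at this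
    linarith
  have hx0 : dir * p ≠ 0 := mul_ne_zero dir_ne_zero (norm_pos_iff.1 (by linarith))
  rw [kernel_eq, norm_div, norm_mul]
  have hden : 1 ≤ ‖2 * I * sin (π * (dir * p))‖ := by
    rw [norm_mul, norm_mul, norm_I, Complex.norm_ofNat, mul_one]
    have h1 := (abs_le_abs_sinh _).trans (abs_sinh_im_le_norm_sin (π * (dir * p)))
    rw [im_ofReal_mul, dir_mul_im, hpre, hpim] at h1
    have h2 : 1 / 2 ≤ |π * (-(√2 / 2) * (u + τ))| := by
      rw [abs_mul, abs_mul, abs_neg, abs_of_pos Real.pi_pos, abs_of_pos (by positivity : 0 < √2 / 2)]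
      have h3 : 1 / 2 ≤ |u + τ| := by
        have := abs_sub_abs_le_abs_sub u (-τ)
        rw [abs_neg, abs_of_nonneg hτ0, sub_neg_eq_add] at this
        linarith
      have h4 : 1 ≤ π * (√2 / 2) := by nlinarith
      nlinarith
    linarith
  have hpow : ‖(dir * p) ^ (-s)‖ ≤ Real.exp (π * |s.im|) * (k.factorial * Real.exp (2 * |u|)) := by
    rw [norm_cpow_of_ne_zero hx0, norm_mul, norm_dir, one_mul, div_eq_mul_inv, ← Real.exp_neg,
      mul_comm]
    have h1 : ‖p‖ ^ (-s).re ≤ k.factorial * Real.exp (2 * |u|) := by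
      calc ‖p‖ ^ (-s).re ≤ ‖p‖ ^ (k : ℝ) := Real.rpow_le_rpow_of_exponent_le hpn1 (by simpa using hk)
        _ = ‖p‖ ^ k := Real.rpow_natCast _ _
        _ ≤ (2 * |u|) ^ k := by gcongr
        _ ≤ _ := by
          have := Real.pow_div_factorial_le_exp (2 * |u|) (by positivity) k
          rwa [div_le_iff₀' (by positivity)] at this
    have h2 : Real.exp (-((dir * p).arg * (-s).im)) ≤ Real.exp (π * |s.im|) := by
      rw [Real.exp_le_exp]
      refine (le_abs_self _).trans ?_
      rw [abs_neg, abs_mul, neg_im, abs_neg]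
      gcongr
      exact abs_arg_le_pi _
    gcongr
  have hexp : ‖exp (π * I * (dir * p) ^ 2)‖ ≤ Real.exp π * Real.exp (-2 * u ^ 2) := by
    rw [norm_exp, ← Real.exp_add, Real.exp_le_exp, mul_pow, dir_sq,
      show π * I * (I * p ^ 2) = ((-π : ℝ) : ℂ) * p ^ 2 by
        push_cast; linear_combination (π * p ^ 2) * I_sq, re_ofReal_mul, sq p, mul_re, hpre, hpim]
    have : τ * τ ≤ 1 := by nlinarith
    nlinarith [sq_nonneg u]
  have h2u : 2 * |u| ≤ 1 + u ^ 2 := by rw [← sq_abs]; nlinarith [sq_nonneg (|u| - 1)]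
  calc _ ≤ ‖(dir * p) ^ (-s)‖ * ‖exp (π * I * (dir * p) ^ 2)‖ := div_le_self (by positivity) hden
    _ ≤ Real.exp (π * |s.im|) * (k.factorial * Real.exp (2 * |u|)) *
        (Real.exp π * Real.exp (-2 * u ^ 2)) := by gcongr
    _ ≤ Real.exp (π * |s.im|) * (k.factorial * Real.exp (1 + u ^ 2)) *
        (Real.exp π * Real.exp (-2 * u ^ 2)) := by gcongr
    _ = _ := by
      rw [Real.exp_add, show -2 * u ^ 2 = -u ^ 2 + -u ^ 2 by ring, Real.exp_add,
        Real.exp_neg (u ^ 2)]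
      field_simp

theorem continuous_kernel_dir_line {s : ℂ} (hs : s.re < -1) {τ : ℝ} (hτ : τ ∈ Icc 0 (√2 / 4)) :
    Continuous fun u : ℝ => kernel s (dir * (u + τ * I)) :=
  (continuousOn_kernel_dir hs).comp_continuous (f := fun u : ℝ => (u : ℂ) + τ * I) (by fun_prop)
    (fun u => by simpa using hτ)

theorem integrable_kernel_dir_line {s : ℂ} (hs : s.re < -1) {τ : ℝ} (hτ : τ ∈ Icc 0 (√2 / 4)) :
    Integrable fun u : ℝ => kernel s (dir * (u + τ * I)) := by
  obtain ⟨C, hC⟩ := exists_norm_kernel_dir_le s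
  exact integrable_of_le_exp_neg_sq (continuous_kernel_dir_line hs hτ) fun u hu => hC u τ hu hτ

/-- The path of integration of `auxR` can be moved to the origin. -/
theorem auxR_eq_integral_through_zero {s : ℂ} (hs : s.re < -1) :
    auxR s = (∫ u : ℝ, kernel s (dir * u)) * dir := by
  have hsp : 0 < √2 := by positivity
  obtain ⟨C, hC⟩ := exists_norm_kernel_dir_le s
  have hε : √2 / 4 ∈ Icc 0 (√2 / 4) := ⟨by positivity, le_rfl⟩
  have h0 : (0 : ℝ) ∈ Icc 0 (√2 / 4) := ⟨le_rfl, by positivity⟩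
  have key := integral_strip_eq (F := fun p => kernel s (dir * p)) hε.1
    (continuousOn_kernel_dir hs) (differentiableOn_kernel_dir s)
    (g := fun x => C * Real.exp (-x ^ 2))
    (by
      have h1 : Tendsto (fun x : ℝ => x ^ 2) atTop atTop := tendsto_pow_atTop two_ne_zero
      simpa using (Real.tendsto_exp_neg_atTop_nhds_zero.comp h1).const_mul C)
    (fun u τ hu hτ => by simpa [sq_abs] using hC u τ hu hτ)
    (integrable_kernel_dir_line hs h0) (integrable_kernel_dir_line hs hε)
  simp only [ofReal_zero, zero_mul, add_zero] at key
  rw [key, ← integral_sub_right_eq_self (fun u : ℝ => kernel s (dir * (u + (√2 / 4 : ℝ) * I))) (√2 / 4),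
    ← integral_mul_const, auxR]
  congr 1; ext u
  rw [← dir]
  congr 2
  have h2 : ((√2 : ℝ) : ℂ) ^ 2 = 2 := by
    exact_mod_cast Real.sq_sqrt (show (0 : ℝ) ≤ 2 by norm_num)
  rw [dir_eq]; push_cast
  linear_combination (-(1 : ℂ) / 4) * h2 + ((√2 : ℂ) ^ 2 / 8) * I_sq

/-! ### Folding the path onto one ray. -/

/-- The direction `e^{πi/4}`. -/
noncomputable def ray : ℂ := exp (π * I / 4)

theorem dir_eq_neg_ray : dir = -ray := by
  rw [dir, ray, show -exp (π * I / 4) = exp (-(π * I)) * exp (π * I / 4) by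
    rw [exp_neg_pi_mul_I]; ring, ← Complex.exp_add]
  congr 1; ring

theorem ray_ne_zero : ray ≠ 0 := exp_ne_zero _

theorem ray_mul_rot : ray * rot = 1 := by
  rw [ray, rot, ← Complex.exp_add, add_neg_cancel, Complex.exp_zero]

theorem neg_I_mul_ray : -I * ray = rot := by
  rw [← rot_sq, sq, mul_assoc, mul_comm rot ray, ray_mul_rot, mul_one]

theorem ray_im : ray.im = √2 / 2 := by
  have h : ray = -dir := by rw [dir_eq_neg_ray, neg_neg]
  rw [h, dir_eq]; simp

theorem mul_ray_cpow {u : ℝ} (hu : 0 < u) (s : ℂ) :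
    (u * ray : ℂ) ^ (-s) = (u : ℂ) ^ (-s) * exp (-(π * I * s / 4)) := by
  have hu0 : (u : ℂ) ≠ 0 := by exact_mod_cast hu.ne'
  have hlog : log (u * ray) = (Real.log u : ℂ) + π * I / 4 := by
    rw [log_ofReal_mul hu ray_ne_zero, ray,
      log_exp (by simp; linarith [Real.pi_pos]) (by simp; linarith [Real.pi_pos])]
  rw [cpow_def_of_ne_zero (mul_ne_zero hu0 ray_ne_zero), cpow_def_of_ne_zero hu0, hlog,
    ← Complex.exp_add, ofReal_log hu.le]
  congr 1; ring

theorem mul_dir_cpow {u : ℝ} (hu : 0 < u) (s : ℂ) :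
    (dir * u : ℂ) ^ (-s) = (u : ℂ) ^ (-s) * exp (3 * π * I * s / 4) := by
  have hu0 : (u : ℂ) ≠ 0 := by exact_mod_cast hu.ne'
  have hlog : log (u * dir) = (Real.log u : ℂ) + -(3 * π * I / 4) := by
    rw [log_ofReal_mul hu dir_ne_zero, dir,
      log_exp (by simp; linarith [Real.pi_pos]) (by simp; linarith [Real.pi_pos])]
  rw [mul_comm dir, cpow_def_of_ne_zero (mul_ne_zero hu0 dir_ne_zero), cpow_def_of_ne_zero hu0,
    hlog, ← Complex.exp_add, ofReal_log hu.le]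
  congr 1; ring

/-- The integrand of `auxR` on the ray of direction `e^{πi/4}`, without the power of `e^{πi/4}`. -/
noncomputable def rayIntegrand (s : ℂ) (u : ℝ) : ℂ :=
  (u : ℂ) ^ (-s) * (exp (π * I * (u * ray) ^ 2) / (2 * I * sin (π * (u * ray))))

theorem kernel_dir_neg {u : ℝ} (hu : 0 < u) (s : ℂ) :
    kernel s (dir * ((-u : ℝ) : ℂ)) = exp (-(π * I * s / 4)) * rayIntegrand s u := by
  rw [show dir * ((-u : ℝ) : ℂ) = u * ray by rw [dir_eq_neg_ray]; push_cast; ring, kernel_eq,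
    mul_ray_cpow hu, rayIntegrand]
  ring

theorem kernel_dir_pos {u : ℝ} (hu : 0 < u) (s : ℂ) :
    kernel s (dir * u) = -exp (3 * π * I * s / 4) * rayIntegrand s u := by
  rw [kernel_eq, mul_dir_cpow hu, rayIntegrand,
    show dir * u = -(u * ray) by rw [dir_eq_neg_ray]; ring, neg_sq, mul_neg, Complex.sin_neg,
    mul_neg, div_neg]
  ring

theorem integrable_kernel_dir {s : ℂ} (hs : s.re < -1) :
    Integrable fun u : ℝ => kernel s (dir * u) := by
  simpa using integrable_kernel_dir_line hs (τ := 0) ⟨le_rfl, by positivity⟩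

theorem integrableOn_rayIntegrand {s : ℂ} (hs : s.re < -1) :
    IntegrableOn (rayIntegrand s) (Ioi 0) := by
  have h : IntegrableOn (fun u : ℝ => -exp (-(3 * π * I * s / 4)) * kernel s (dir * u)) (Ioi 0) :=
    ((integrable_kernel_dir hs).integrableOn (s := Ioi 0)).const_mul
    (-exp (-(3 * π * I * s / 4)))
  refine h.congr_fun (fun u hu => ?_) measurableSet_Ioi
  simp only
  rw [kernel_dir_pos hu, ← mul_assoc, neg_mul_neg, ← Complex.exp_add, neg_add_cancel,
    Complex.exp_zero, one_mul]

/-- The two halves of the line are `x = ±u * ray`. Their integrands differ by the phase of `x^{-s}`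
(argument `π/4` or `-3π/4`) and by the sign of the odd sine. -/
theorem auxR_eq_ray {s : ℂ} (hs : s.re < -1) :
    auxR s = (exp (3 * π * I * s / 4) - exp (-(π * I * s / 4))) * ray *
      ∫ u in Ioi (0 : ℝ), rayIntegrand s u := by
  have hline := integrable_kernel_dir hs
  rw [auxR_eq_integral_through_zero hs,
    ← intervalIntegral.integral_Iic_add_Ioi (b := 0) hline.integrableOn hline.integrableOn]
  have h1 : ∫ u in Iic (0 : ℝ), kernel s (dir * u) =
      exp (-(π * I * s / 4)) * ∫ u in Ioi (0 : ℝ), rayIntegrand s u := by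
    have := integral_comp_neg_Ioi (0 : ℝ) (fun u : ℝ => kernel s (dir * u))
    rw [neg_zero] at this
    rw [← this, ← integral_const_mul]
    exact setIntegral_congr_fun measurableSet_Ioi fun u hu => kernel_dir_neg hu s
  have h2 : ∫ u in Ioi (0 : ℝ), kernel s (dir * u) =
      -exp (3 * π * I * s / 4) * ∫ u in Ioi (0 : ℝ), rayIntegrand s u := by
    rw [← integral_const_mul]
    exact setIntegral_congr_fun measurableSet_Ioi fun u hu => kernel_dir_pos hu s
  rw [h1, h2, dir_eq_neg_ray]
  ring

/-- The argument of `rot * x` lies in `(-π/2, π/2)`; adding `π/4` does not leave the principal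
range. -/
theorem log_two_pi_rot_mul {x : ℂ} (hx : 0 < (rot * x).re) :
    log (2 * π * (rot * x)) = (Real.log (2 * π) : ℂ) + (log x - π * I / 4) := by
  have hx0 : rot * x ≠ 0 := fun h => by rw [h] at hx; simp at hx
  have h1 : log (2 * π * (rot * x)) = (Real.log (2 * π) : ℂ) + log (rot * x) := by
    rw [← log_ofReal_mul Real.two_pi_pos hx0]; push_cast; rfl
  have harg := abs_lt.1 (abs_arg_lt_pi_div_two_iff.2 (Or.inl hx))
  have h2 : log x = log (rot * x) + π * I / 4 := by
    have hxe : x = exp (log (rot * x) + π * I / 4) := by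
      rw [Complex.exp_add, exp_log hx0, ← ray, mul_comm, ← mul_assoc, ray_mul_rot, one_mul]
    have him : (log (rot * x) + π * I / 4).im = (rot * x).arg + π / 4 := by
      simp [log_im]
    conv_lhs => rw [hxe]
    rw [log_exp] <;> rw [him] <;> linarith [Real.pi_pos, harg.1, harg.2]
  rw [h1, h2]; ring

/-- `∫ u^{-s} e^{2πi x u e^{πi/4}} du` over the positive half-line. -/
theorem integral_cpow_mul_exp_ray {s x : ℂ} (hs : s.re < 1) (hx : 0 < (rot * x).re) :
    ∫ u in Ioi (0 : ℝ), (u : ℂ) ^ (-s) * exp (2 * π * I * x * (u * ray)) =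
      Gamma (1 - s) * ((2 * π : ℂ) ^ (s - 1) * exp (-(π * I * (s - 1) / 4))) * x ^ (s - 1) := by
  have hr : 0 < (2 * π * (rot * x)).re := by
    rw [show 2 * π * (rot * x) = ((2 * π : ℝ) : ℂ) * (rot * x) by push_cast; ring, re_ofReal_mul]
    exact mul_pos Real.two_pi_pos hx
  have h := integral_cpow_mul_exp_neg_mul_Ioi_of_re_pos (a := 1 - s) (by simpa using hs) hr
  have e : ∀ u : ℝ, (u : ℂ) ^ (-s) * exp (2 * π * I * x * (u * ray)) =
      (u : ℂ) ^ (1 - s - 1) * exp (-(2 * π * (rot * x) * u)) := by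
    intro u
    rw [show (1 : ℂ) - s - 1 = -s by ring, ← neg_I_mul_ray]
    congr 2; ring
  simp only [e]
  rw [h, mul_comm, mul_assoc (Gamma (1 - s))]
  refine congrArg (Gamma (1 - s) * ·) ?_
  have hr0 : 2 * π * (rot * x) ≠ 0 := fun h => by rw [h] at hr; simp at hr
  have hx0 : x ≠ 0 := fun h => by rw [h] at hx; simp at hx
  have h2π : (2 * π : ℂ) ≠ 0 := by exact_mod_cast Real.two_pi_pos.ne'
  have harg : (2 * π * (rot * x)).arg ≠ π := by
    have := abs_lt.1 (abs_arg_lt_pi_div_two_iff.2 (Or.inl hr))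
    have := Real.pi_pos
    intro h; linarith
  rw [one_div, inv_cpow _ _ harg, ← cpow_neg, cpow_def_of_ne_zero hr0, log_two_pi_rot_mul hx,
    cpow_def_of_ne_zero h2π, cpow_def_of_ne_zero hx0, ← Complex.exp_add, ← Complex.exp_add,
    ofReal_log Real.two_pi_pos.le]
  congr 1; push_cast; ring

theorem quad_one_eq (y x : ℂ) : quad 1 y x = exp (-(π * I * x ^ 2)) * exp (2 * π * I * x * y) := by
  rw [quad, ← Complex.exp_add]; congr 1; push_cast; ring

/-! ### The double integral and the dual representation of `auxR`. -/

/-- The kernel of the double integral. -/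
noncomputable def doubleKernel (s : ℂ) (N : ℕ) (u v : ℝ) : ℂ :=
  (u : ℂ) ^ (-s) * (quad 1 (u * ray) (N + 1 / 2 + v * rot) /
    (2 * I * sin (π * (N + 1 / 2 + v * rot))) * rot)

/-- Because `ray * rot = 1`, the cross term `e^{2πi uv}` is unimodular. What remains is a product of
a function of `u` and a function of `v`, which gives the absolute integrability for Fubini. -/
theorem doubleKernel_eq (s : ℂ) (N : ℕ) (u v : ℝ) :
    doubleKernel s N u v = exp (((2 * π * (u * v) : ℝ) : ℂ) * I) *
      (((u : ℂ) ^ (-s) * exp (-(2 * π * (rot * (N + 1 / 2)) * u))) *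
        (quad 1 0 (((N : ℤ) : ℂ) + 1 / 2 + v * rot) /
          (2 * I * sin (π * (((N : ℤ) : ℂ) + 1 / 2 + v * rot))) * rot)) := by
  have h : exp (2 * π * I * (N + 1 / 2 + v * rot) * (u * ray)) =
      exp (((2 * π * (u * v) : ℝ) : ℂ) * I) * exp (-(2 * π * (rot * (N + 1 / 2)) * u)) := by
    rw [← Complex.exp_add]
    congr 1; push_cast
    linear_combination (2 * π * I * v * u) * ray_mul_rot -
      (2 * π * (N + 1 / 2) * u : ℂ) * neg_I_mul_ray
  rw [doubleKernel, Int.cast_natCast, quad_one_eq, quad_one_eq, mul_zero, Complex.exp_zero, mul_one, h]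
  ring

theorem rot_mul_half_re (N : ℕ) : 0 < (2 * π * (rot * (N + 1 / 2))).re := by
  have : (2 * π * (rot * (N + 1 / 2))).re = 2 * π * (√2 / 2 * (N + 1 / 2)) := by simp
  rw [this]
  have := Real.pi_pos
  positivity

theorem integrable_doubleKernel {s : ℂ} (hs : s.re < 1) (N : ℕ) :
    Integrable (Function.uncurry (doubleKernel s N)) ((volume.restrict (Ioi 0)).prod volume) := by
  have h1 : IntegrableOn (fun u : ℝ => (u : ℂ) ^ (-s) * exp (-(2 * π * (rot * (N + 1 / 2)) * u)))
      (Ioi 0) := integrableOn_cpow_mul_exp_neg (by simpa using hs) (rot_mul_half_re N)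
  have h2 := integrable_quad_div_sin le_rfl 0 N
  have h3 := Integrable.mul_prod h1 h2
  have h4 := h3.bdd_mul (c := 1)
    (f := fun z : ℝ × ℝ => exp (((2 * π * (z.1 * z.2) : ℝ) : ℂ) * I))
    (Continuous.aestronglyMeasurable (by fun_prop))
    (Eventually.of_forall fun z => (norm_exp_ofReal_mul_I _).le)
  refine h4.congr (Eventually.of_forall fun z => ?_)
  simp only [Function.uncurry]
  rw [doubleKernel_eq]

theorem integral_doubleKernel_right (s : ℂ) (N : ℕ) (u : ℝ) :
    ∫ v, doubleKernel s N u v = (u : ℂ) ^ (-s) * lineInt (quad 1 (u * ray)) (N + 1 / 2) := by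
  unfold doubleKernel lineInt
  rw [integral_const_mul]

/-- The integrand of the conjugate representation of the auxiliary function. -/
noncomputable def powGauss (s x : ℂ) : ℂ := x ^ (s - 1) * exp (-(π * I * x ^ 2))

/-- The constant of `integral_cpow_mul_exp_ray`. -/
noncomputable def rayConst (s : ℂ) : ℂ :=
  Gamma (1 - s) * ((2 * π : ℂ) ^ (s - 1) * exp (-(π * I * (s - 1) / 4)))

theorem rot_mul_line_re (N : ℕ) (v : ℝ) : 0 < (rot * (N + 1 / 2 + v * rot)).re := by
  rw [show rot * (N + 1 / 2 + v * rot) = rot * (N + 1 / 2) + v * rot ^ 2 by ring, rot_sq]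
  have : (rot * (N + 1 / 2) + v * -I).re = √2 / 2 * (N + 1 / 2) := by simp
  rw [this]
  positivity

theorem integral_doubleKernel_left {s : ℂ} (hs : s.re < 1) (N : ℕ) (v : ℝ) :
    ∫ u in Ioi (0 : ℝ), doubleKernel s N u v =
      rayConst s * (powGauss s (N + 1 / 2 + v * rot) /
        (2 * I * sin (π * (N + 1 / 2 + v * rot))) * rot) := by
  have h := integral_cpow_mul_exp_ray hs (rot_mul_line_re N v)
  set x : ℂ := N + 1 / 2 + v * rot with hx
  have e : ∀ u : ℝ, doubleKernel s N u v = ((u : ℂ) ^ (-s) * exp (2 * π * I * x * (u * ray))) *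
      (exp (-(π * I * x ^ 2)) / (2 * I * sin (π * x)) * rot) := by
    intro u
    rw [doubleKernel, quad_one_eq]; ring
  simp only [e]
  rw [integral_mul_const, h, rayConst, powGauss]
  ring

theorem integral_lineInt_ray {s : ℂ} (hs : s.re < 1) (N : ℕ) :
    ∫ u in Ioi (0 : ℝ), (u : ℂ) ^ (-s) * lineInt (quad 1 (u * ray)) (N + 1 / 2) =
      rayConst s * lineInt (powGauss s) (N + 1 / 2) := by
  simp only [← integral_doubleKernel_right]
  rw [integral_integral_swap (integrable_doubleKernel hs N)]
  simp only [integral_doubleKernel_left hs]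
  rw [integral_const_mul, lineInt]

theorem norm_exp_ray (n : ℕ) (u : ℝ) :
    ‖exp (2 * π * I * n * (u * ray))‖ = Real.exp (-(√2 * π * n * u)) := by
  rw [norm_exp]
  congr 1
  have : (2 * π * I * n * (u * ray)).re = -(2 * π * n * (u * ray.im)) := by
    simp
  rw [this, ray_im]; ring

theorem integrableOn_term {s : ℂ} (hs : s.re < 1) (n : ℕ) (hn : 0 < n) :
    IntegrableOn (fun u : ℝ => (u : ℂ) ^ (-s) * exp (2 * π * I * n * (u * ray))) (Ioi 0) := by
  have hr : 0 < (2 * π * (rot * n)).re := by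
    have : (2 * π * (rot * n)).re = 2 * π * (√2 / 2 * n) := by simp
    rw [this]
    have := Real.pi_pos
    positivity
  refine (integrableOn_cpow_mul_exp_neg (a := -s) (by simpa using hs) hr).congr_fun
    (fun u _ => ?_) measurableSet_Ioi
  simp only
  rw [← neg_I_mul_ray]
  congr 2; ring

theorem integral_norm_term {s : ℂ} (hs : s.re < 1) (n : ℕ) (hn : 0 < n) :
    ∫ u in Ioi (0 : ℝ), ‖(u : ℂ) ^ (-s) * exp (2 * π * I * n * (u * ray))‖ =
      (1 / (√2 * π)) ^ (1 - s.re) * Real.Gamma (1 - s.re) * (n : ℝ) ^ (s.re - 1) := by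
  have hπ := Real.pi_pos
  have hn' : (0 : ℝ) < n := by exact_mod_cast hn
  have h := Real.integral_rpow_mul_exp_neg_mul_Ioi (a := 1 - s.re) (r := √2 * π * n)
    (by linarith) (by positivity)
  have e : ∀ u ∈ Ioi (0 : ℝ), ‖(u : ℂ) ^ (-s) * exp (2 * π * I * n * (u * ray))‖ =
      u ^ (1 - s.re - 1) * Real.exp (-(√2 * π * n * u)) := by
    intro u hu
    rw [norm_mul, norm_exp_ray, norm_cpow_eq_rpow_re_of_pos hu]
    congr 2; simp
  rw [setIntegral_congr_fun measurableSet_Ioi e, h, one_div, one_div, mul_inv,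
    Real.mul_rpow (by positivity) (by positivity), Real.inv_rpow hn'.le, ← Real.rpow_neg hn'.le,
    neg_sub]
  ring

/-- Termwise integration is allowed since the `L¹` norms are a constant times `n^{σ-1}`, summable
for `σ < 0`. -/
theorem hasSum_integral_term {s : ℂ} (hs : s.re < 0) (N : ℕ) :
    HasSum (fun k : ℕ => rayConst s * ((N + 1 + k : ℕ) : ℂ) ^ (s - 1))
      (∫ u in Ioi (0 : ℝ), (u : ℂ) ^ (-s) *
        ∑' k : ℕ, exp (2 * π * I * ((N + 1 + k : ℕ) : ℂ) * (u * ray))) := by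
  have h := hasSum_integral_of_summable_integral_norm (μ := volume.restrict (Ioi (0 : ℝ)))
    (F := fun (k : ℕ) (u : ℝ) => (u : ℂ) ^ (-s) * exp (2 * π * I * ((N + 1 + k : ℕ) : ℂ) * (u * ray)))
    (fun k => integrableOn_term (by linarith) _ (by omega)) (by
      refine Summable.congr ?_ fun k =>
        (integral_norm_term (show s.re < 1 by linarith) (N + 1 + k) (by omega)).symm
      refine Summable.mul_left _ ?_
      have h1 : Summable fun n : ℕ => (n : ℝ) ^ (s.re - 1) :=
        Real.summable_nat_rpow.2 (by linarith)
      refine (h1.comp_injective (add_right_injective (N + 1))).congr fun k => ?_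
      rfl)
  simp only [tsum_mul_left] at h
  refine h.congr_fun fun k => ?_
  rw [integral_cpow_mul_exp_ray (by linarith), rayConst]
  have : (rot * ((N + 1 + k : ℕ) : ℂ)).re = √2 / 2 * ((N + 1 + k : ℕ) : ℝ) := by
    rw [mul_re, natCast_re, natCast_im, rot_re]; ring
  rw [this]
  positivity

theorem chi_eq (s : ℂ) :
    (exp (3 * π * I * s / 4) - exp (-(π * I * s / 4))) * ray * rayConst s = -chi s := by
  have h2π : (2 * π : ℂ) ^ (s - 1) = 2 ^ (s - 1) * (π : ℂ) ^ (s - 1) := by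
    have := mul_cpow_ofReal_nonneg (show (0 : ℝ) ≤ 2 by norm_num) Real.pi_pos.le (s - 1)
    simpa using this
  have h2 : (2 : ℂ) ^ s = 2 * 2 ^ (s - 1) := by
    rw [cpow_sub _ _ two_ne_zero, cpow_one]; field_simp
  have hs : (exp (3 * π * I * s / 4) - exp (-(π * I * s / 4))) * ray *
      exp (-(π * I * (s - 1) / 4)) = -(2 * sin (π * s / 2)) := by
    have h3 : 2 * sin (π * s / 2) = exp (-(π * s / 2 * I) + π / 2 * I) -
        exp (π * s / 2 * I + π / 2 * I) := by
      rw [Complex.exp_add, Complex.exp_add, exp_pi_div_two_mul_I, Complex.sin]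
      rw [neg_mul]; ring
    rw [h3, ray, sub_mul, sub_mul]
    simp only [← Complex.exp_add]
    rw [neg_sub]
    congr 2 <;> ring
  rw [rayConst, chi, h2π, h2]
  linear_combination (Gamma (1 - s) * 2 ^ (s - 1) * (π : ℂ) ^ (s - 1)) * hs

/-- The representation of `auxR` by a tail of the series for `ζ(1-s)` and an integral over a line
to the right. -/
theorem auxR_eq_chi_mul {s : ℂ} (hs : s.re < -1) (N : ℕ) :
    auxR s = chi s * ((∑' k : ℕ, ((N + 1 + k : ℕ) : ℂ) ^ (s - 1)) -
      lineInt (powGauss s) (N + 1 / 2)) := by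
  have hA : IntegrableOn (fun u : ℝ => (u : ℂ) ^ (-s) * lineInt (quad 1 (u * ray)) (N + 1 / 2))
      (Ioi 0) := by
    have := (integrable_doubleKernel (show s.re < 1 by linarith) N).integral_prod_left
    refine Integrable.congr this (Eventually.of_forall fun u => ?_)
    exact integral_doubleKernel_right s N u
  have hsplit : ∀ u ∈ Ioi (0 : ℝ), rayIntegrand s u =
      (u : ℂ) ^ (-s) * lineInt (quad 1 (u * ray)) (N + 1 / 2) -
        (u : ℂ) ^ (-s) * ∑' k : ℕ, exp (2 * π * I * ((N + 1 + k : ℕ) : ℂ) * (u * ray)) := by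
    intro u hu
    have hy : 0 < ((u : ℂ) * ray).im := by
      rw [im_ofReal_mul, ray_im]
      have : (0 : ℝ) < u := hu
      positivity
    rw [rayIntegrand, exp_div_sin_eq_lineInt_sub hy N, mul_sub]
  -- Integrability of the series comes by difference: the line integral is integrable by Fubini, the
  -- ray integrand by the contour shift.
  have hB : IntegrableOn (fun u : ℝ => (u : ℂ) ^ (-s) *
      ∑' k : ℕ, exp (2 * π * I * ((N + 1 + k : ℕ) : ℂ) * (u * ray))) (Ioi 0) := by
    refine (hA.sub (integrableOn_rayIntegrand hs)).congr_fun (fun u hu => ?_) measurableSet_Ioi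
    simp only [Pi.sub_apply]
    rw [hsplit u hu]; ring
  rw [auxR_eq_ray hs, setIntegral_congr_fun measurableSet_Ioi hsplit, integral_sub hA hB,
    integral_lineInt_ray (by linarith), ← (hasSum_integral_term (by linarith) N).tsum_eq,
    tsum_mul_left]
  linear_combination (lineInt (powGauss s) (N + 1 / 2) -
    ∑' k : ℕ, ((N + 1 + k : ℕ) : ℂ) ^ (s - 1)) * chi_eq s

/-! ### The phase near the saddle point. -/

/-- Mean value inequality along `[0, z]`. Keeping `‖exp z‖` instead of `exp ‖z‖` matters: multiplied
by the Gaussian it becomes the true integrand, which has its own decay bound. -/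
theorem norm_exp_sub_one_le_mul (z : ℂ) : ‖exp z - 1‖ ≤ ‖z‖ * (1 + ‖exp z‖) := by
  have h := norm_image_sub_le_of_norm_deriv_le_segment_01' (f := fun t : ℝ => exp (t * z))
    (f' := fun t : ℝ => exp (t * z) * z) (C := ‖z‖ * (1 + ‖exp z‖)) (fun t _ => by
      have h1 : HasDerivAt (fun t : ℝ => (t : ℂ) * z) (1 * z) t :=
        (hasDerivAt_id t).ofReal_comp.mul_const z
      simpa using h1.cexp.hasDerivWithinAt) (fun t ht => by
      rw [norm_mul, mul_comm, norm_exp, norm_exp, re_ofReal_mul]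
      gcongr
      rcases le_total z.re 0 with hz | hz
      · have : Real.exp (t * z.re) ≤ 1 := Real.exp_le_one_iff.2 (mul_nonpos_of_nonneg_of_nonpos ht.1 hz)
        linarith [Real.exp_pos z.re]
      · have : Real.exp (t * z.re) ≤ Real.exp z.re := by
          rw [Real.exp_le_exp]; nlinarith [ht.2]
        linarith)
  simpa using h

/-- The convex half-plane `Re z + Im z > 0` is the working domain: it avoids the cut and contains
`η`, the lines through `N + 1/2`, the positive reals and all segments between them. -/
theorem mem_slitPlane_of_re_add_im_pos {z : ℂ} (h : 0 < z.re + z.im) : z ∈ slitPlane := by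
  rw [mem_slitPlane_iff]
  by_cases hi : z.im = 0
  · left; linarith
  · exact Or.inr hi

theorem sq_re_add_im_le (z : ℂ) : (z.re + z.im) ^ 2 ≤ 2 * ‖z‖ ^ 2 := by
  rw [← normSq_eq_norm_sq, normSq_apply]; nlinarith [sq_nonneg (z.re - z.im)]

theorem half_re_add_im_le_norm (z : ℂ) : (z.re + z.im) / 2 ≤ ‖z‖ := by
  linarith [re_le_norm z, im_le_norm z]

/-- The logarithm of `x^{s-1} e^{-πi x²}`, relative to its value at the saddle point `η`, where
`s - 1 = 2πi η²`. -/
noncomputable def logRatio (η x : ℂ) : ℂ :=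
  2 * π * I * η ^ 2 * (log x - log η) - π * I * (x ^ 2 - η ^ 2)

theorem logRatio_self (η : ℂ) : logRatio η η = 0 := by simp [logRatio]

/-- In `x` the derivative is `2πi(η² - x²)/x = -2πi (x - η)(1 + η/x)`, with `x - η = τd`. -/
theorem hasDerivAt_logRatio_segment (η d : ℂ) (τ : ℝ) (h : η + τ * d ∈ slitPlane) :
    HasDerivAt (fun τ : ℝ => logRatio η (η + τ * d))
      (-(2 * π * I * d ^ 2 * τ * (1 + η / (η + τ * d)))) τ := by
  have h0 : η + τ * d ≠ 0 := slitPlane_ne_zero h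
  have h1 : HasDerivAt (fun τ : ℝ => η + (τ : ℂ) * d) (1 * d) τ :=
    ((hasDerivAt_id τ).ofReal_comp.mul_const d).const_add η
  have h2 := (((h1.clog_real h).sub_const (log η)).const_mul (2 * π * I * η ^ 2)).sub
    (((h1.pow 2).sub_const (η ^ 2)).const_mul (π * I))
  refine h2.congr_deriv ?_
  obtain ⟨γ, hγ⟩ : ∃ γ, γ = η + τ * d := ⟨_, rfl⟩
  rw [← hγ] at h0 ⊢
  rw [eq_sub_of_add_eq hγ.symm]
  field_simp
  push_cast
  ring

theorem segment_re_add_im {η d : ℂ} {τ a : ℝ} (h0 : 0 ≤ τ) (h1 : τ ≤ 1) (hη : a ≤ η.re + η.im)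
    (hx : a ≤ (η + d).re + (η + d).im) : a ≤ (η + τ * d).re + (η + τ * d).im := by
  have e : (η + τ * d).re + (η + τ * d).im =
      (1 - τ) * (η.re + η.im) + τ * ((η + d).re + (η + d).im) := by
    simp; ring
  rw [e]
  nlinarith

/-- Cauchy's mean value theorem against `τ²`, whose derivative `2τ` cancels the factor `τ` of the
derivative of the phase. -/
theorem exists_re_logRatio_eq {η d : ℂ} (hη : 0 < η.re + η.im)
    (hx : 0 < (η + d).re + (η + d).im) :
    ∃ τ ∈ Ioo (0 : ℝ) 1,
      (logRatio η (η + d)).re = -π * (I * d ^ 2 * (1 + η / (η + τ * d))).re := by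
  have hpos : ∀ τ ∈ Icc (0 : ℝ) 1, η + τ * d ∈ slitPlane := fun τ hτ => by
    apply mem_slitPlane_of_re_add_im_pos
    exact (lt_min hη hx).trans_le
      (segment_re_add_im hτ.1 hτ.2 (min_le_left _ _) (min_le_right _ _))
  have hder : ∀ τ ∈ Icc (0 : ℝ) 1, HasDerivAt (fun τ : ℝ => (logRatio η (η + τ * d)).re)
      (-(2 * π * I * d ^ 2 * τ * (1 + η / (η + τ * d)))).re τ := fun τ hτ =>
    (reCLM.hasFDerivAt.comp_hasDerivAt τ (hasDerivAt_logRatio_segment η d τ (hpos τ hτ)))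
  obtain ⟨τ, hτ, h⟩ := exists_ratio_hasDerivAt_eq_ratio_slope
    (fun τ : ℝ => (logRatio η (η + τ * d)).re)
    (fun τ : ℝ => (-(2 * π * I * d ^ 2 * τ * (1 + η / (η + τ * d)))).re) one_pos
    (fun τ hτ => (hder τ hτ).continuousAt.continuousWithinAt)
    (fun τ hτ => hder τ (Ioo_subset_Icc_self hτ))
    (fun τ : ℝ => τ ^ 2) (fun τ => 2 * τ) (by fun_prop)
    (fun τ _ => by simpa using hasDerivAt_pow 2 τ)
  refine ⟨τ, hτ, ?_⟩
  simp only [ofReal_one, one_mul, ofReal_zero, zero_mul, add_zero, logRatio_self, zero_re, sub_zero,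
    one_pow, ne_eq, OfNat.ofNat_ne_zero, not_false_eq_true, zero_pow] at h
  have e : -(2 * π * I * d ^ 2 * τ * (1 + η / (η + τ * d))) =
      ((-(2 * π * τ) : ℝ) : ℂ) * (I * d ^ 2 * (1 + η / (η + τ * d))) := by push_cast; ring
  rw [e, re_ofReal_mul] at h
  have hτ0 : 2 * τ ≠ 0 := by have := hτ.1; positivity
  apply mul_right_cancel₀ hτ0
  rw [← h]; ring

/-- Expanding the squared hypothesis gives `‖γ‖² + 2 Re(η γ̄) ≥ 0`. In `re_logRatio_le` it keeps at
least half of the term `-πv²`. -/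
theorem neg_half_le_re_div {η γ : ℂ} (hγ : γ ≠ 0) (h : ‖η‖ ≤ ‖γ + η‖) : -(1 / 2) ≤ (η / γ).re := by
  have h1 : 0 < normSq γ := normSq_pos.2 hγ
  have h2 : normSq η ≤ normSq (γ + η) := by
    rw [normSq_eq_norm_sq, normSq_eq_norm_sq]; gcongr
  rw [div_re, ← add_div, le_div_iff₀ h1]
  simp only [normSq_apply, add_re, add_im] at h1 h2 ⊢
  nlinarith

/-- Gaussian decay along the lines of steepest descent near the saddle point. -/
theorem re_logRatio_le {η : ℂ} (hX : 0 ≤ η.re) (hy : 0 ≤ η.im) (h1 : 1 ≤ η.re + η.im) {δ v : ℝ}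
    (hδ : |δ| ≤ 1 / 2) :
    (logRatio η (η + (δ + v * rot))).re ≤ -(π * v ^ 2 / 2) + 5 * π * (δ ^ 2 + 2 * |δ| * |v|) := by
  have hπ := Real.pi_pos
  obtain ⟨hδ1, hδ2⟩ := abs_le.1 hδ
  set d : ℂ := δ + v * rot with hd
  have hxsum : (η + d).re + (η + d).im = η.re + η.im + δ := by
    simp [hd]; ring
  set a := η.re + η.im with ha
  have hnη : ‖η‖ ≤ a := by
    have := norm_le_abs_re_add_abs_im η
    rwa [abs_of_nonneg hX, abs_of_nonneg hy] at this
  obtain ⟨τ, hτ, h⟩ := exists_re_logRatio_eq (η := η) (d := d) (by linarith) (by linarith)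
  set γ : ℂ := η + τ * d with hγ
  have hγs : a - 1 / 2 ≤ γ.re + γ.im :=
    segment_re_add_im hτ.1.le hτ.2.le (by linarith) (by linarith)
  have hγn : a / 4 ≤ ‖γ‖ := by linarith [half_re_add_im_le_norm γ]
  have hγ0 : γ ≠ 0 := norm_pos_iff.1 (by linarith)
  -- `‖γ + η‖² ≥ (2a - 1/2)²/2 ≥ a² ≥ ‖η‖²`, as `a ≥ 1`.
  have hsum : ‖η‖ ≤ ‖γ + η‖ := by
    apply le_of_sq_le_sq _ (norm_nonneg _)
    have h2 := sq_re_add_im_le (γ + η)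
    have h3 : 2 * a - 1 / 2 ≤ (γ + η).re + (γ + η).im := by
      rw [add_re, add_im]; linarith
    have h4 : (2 * a - 1 / 2) ^ 2 ≤ ((γ + η).re + (γ + η).im) ^ 2 := by
      apply pow_le_pow_left₀ (by linarith) h3
    nlinarith [norm_nonneg η]
  have hre := neg_half_le_re_div hγ0 hsum
  have hq : ‖1 + η / γ‖ ≤ 5 := by
    refine (norm_add_le _ _).trans ?_
    rw [norm_one, norm_div]
    have : ‖η‖ / ‖γ‖ ≤ 4 := by
      rw [div_le_iff₀ (by linarith)]; linarith
    linarith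
  have hd2 : I * d ^ 2 = ((v ^ 2 : ℝ) : ℂ) + (I * δ ^ 2 + 2 * I * δ * v * rot) := by
    rw [hd]; push_cast
    linear_combination (I * (v : ℂ) ^ 2) * rot_sq - (v : ℂ) ^ 2 * I_sq
  have hrem : ‖(I * δ ^ 2 + 2 * I * δ * v * rot) * (1 + η / γ)‖ ≤ (δ ^ 2 + 2 * |δ| * |v|) * 5 := by
    rw [norm_mul]
    gcongr
    refine (norm_add_le _ _).trans (le_of_eq ?_)
    simp
  have hrem' := (abs_le.1 ((abs_re_le_norm _).trans hrem)).1
  rw [h, hd2, add_mul, add_re, re_ofReal_mul, add_re, one_re]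
  have h5 : v ^ 2 / 2 ≤ v ^ 2 * (1 + (η / γ).re) := by nlinarith [sq_nonneg v]
  nlinarith

/-- The deviation of the integrand from the Gaussian at the saddle point. -/
theorem norm_logRatio_add_le {η d : ℂ} (hη : 0 < η.re + η.im)
    (hx : (η.re + η.im) / 2 ≤ (η + d).re + (η + d).im) :
    ‖logRatio η (η + d) + 2 * π * I * d ^ 2‖ ≤ 8 * π * ‖d‖ ^ 3 / (η.re + η.im) := by
  have hπ := Real.pi_pos
  set a := η.re + η.im with ha
  have hseg : ∀ τ ∈ Icc (0 : ℝ) 1, a / 2 ≤ (η + τ * d).re + (η + τ * d).im := fun τ hτ =>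
    segment_re_add_im hτ.1 hτ.2 (by linarith) hx
  have h := norm_image_sub_le_of_norm_deriv_le_segment_01'
    (f := fun τ : ℝ => logRatio η (η + τ * d) + 2 * π * I * d ^ 2 * (τ : ℂ) ^ 2)
    (f' := fun τ : ℝ => -(2 * π * I * d ^ 2 * τ * (1 + η / (η + τ * d))) +
      2 * π * I * d ^ 2 * (2 * τ)) (C := 8 * π * ‖d‖ ^ 3 / a) (fun τ hτ => by
      have h1 := hasDerivAt_logRatio_segment η d τ
        (mem_slitPlane_of_re_add_im_pos (by linarith [hseg τ hτ]))
      have h2 : HasDerivAt (fun τ : ℝ => 2 * π * I * d ^ 2 * (τ : ℂ) ^ 2)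
          (2 * π * I * d ^ 2 * (2 * τ)) τ := by
        have := ((hasDerivAt_id τ).ofReal_comp.pow 2).const_mul (2 * π * I * d ^ 2)
        simpa using this
      exact (h1.add h2).hasDerivWithinAt) (fun τ hτ => by
      have hs := hseg τ (Ico_subset_Icc_self hτ)
      have hγn : a / 4 ≤ ‖η + τ * d‖ := by linarith [half_re_add_im_le_norm (η + τ * d)]
      have hγ0 : η + τ * d ≠ 0 := norm_pos_iff.1 (by linarith)
      -- The quadratic parts cancel and a cubic remainder over `η + τd` is left; the lower bound
      -- `a/4` for that denominator turns `2π` into `8π`.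
      have e : -(2 * π * I * d ^ 2 * τ * (1 + η / (η + τ * d))) + 2 * π * I * d ^ 2 * (2 * τ) =
          2 * π * I * d ^ 3 * (τ : ℂ) ^ 2 / (η + τ * d) := by
        obtain ⟨γ, hγ⟩ : ∃ γ, γ = η + τ * d := ⟨_, rfl⟩
        rw [← hγ] at hγ0 ⊢
        rw [eq_sub_of_add_eq hγ.symm]
        field_simp; ring
      rw [e, norm_div, div_le_div_iff₀ (by linarith) hη]
      simp only [norm_mul, norm_pow, norm_I, Complex.norm_ofNat, norm_real, Real.norm_eq_abs,
        abs_of_pos hπ, sq_abs, mul_one]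
      have hτ2 : τ ^ 2 ≤ 1 := by nlinarith [hτ.1, hτ.2]
      have hd3 : 0 ≤ 2 * π * ‖d‖ ^ 3 := by positivity
      calc 2 * π * ‖d‖ ^ 3 * τ ^ 2 * a ≤ 2 * π * ‖d‖ ^ 3 * 1 * a := by gcongr
        _ = 8 * π * ‖d‖ ^ 3 * (a / 4) := by ring
        _ ≤ _ := by gcongr)
  simpa [logRatio_self] using h

theorem norm_exp_logRatio_sub_le {η d : ℂ} (hη : 0 < η.re + η.im)
    (hx : (η.re + η.im) / 2 ≤ (η + d).re + (η + d).im) :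
    ‖exp (logRatio η (η + d)) - saddleGauss η (η + d)‖ ≤
      8 * π * ‖d‖ ^ 3 / (η.re + η.im) *
        (‖exp (logRatio η (η + d))‖ + ‖saddleGauss η (η + d)‖) := by
  have h1 := norm_logRatio_add_le hη hx
  set L := logRatio η (η + d) with hL
  have h2 := norm_exp_sub_one_le_mul (L + 2 * π * I * d ^ 2)
  have hG : saddleGauss η (η + d) = exp (-(2 * π * I * d ^ 2)) := by
    rw [saddleGauss, add_sub_cancel_left]
  have hE : exp L = saddleGauss η (η + d) * exp (L + 2 * π * I * d ^ 2) := by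
    rw [hG, ← Complex.exp_add]; congr 1; ring
  rw [hE, ← mul_sub_one, norm_mul, norm_mul]
  calc _ ≤ ‖saddleGauss η (η + d)‖ *
        (‖L + 2 * π * I * d ^ 2‖ * (1 + ‖exp (L + 2 * π * I * d ^ 2)‖)) := by gcongr
    _ = ‖L + 2 * π * I * d ^ 2‖ * (‖saddleGauss η (η + d)‖ * ‖exp (L + 2 * π * I * d ^ 2)‖ +
        ‖saddleGauss η (η + d)‖) := by ring
    _ ≤ _ := by gcongr

theorem norm_saddleGauss_le (η : ℂ) {δ v : ℝ} :
    ‖saddleGauss η (η + (δ + v * rot))‖ ≤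
      Real.exp (-(2 * π * v ^ 2) + 2 * π * (δ ^ 2 + 2 * |δ| * |v|)) := by
  have hπ := Real.pi_pos
  rw [saddleGauss, add_sub_cancel_left, norm_exp, Real.exp_le_exp]
  have hd2 : -(2 * π * I * (δ + v * rot) ^ 2) = ((-(2 * π * v ^ 2) : ℝ) : ℂ) -
      ((2 * π : ℝ) : ℂ) * (I * δ ^ 2 + 2 * I * δ * v * rot) := by
    push_cast
    linear_combination (-(2 * π * I * (v : ℂ) ^ 2)) * rot_sq + (2 * π * (v : ℂ) ^ 2) * I_sq
  rw [hd2, sub_re, ofReal_re, re_ofReal_mul]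
  have h : ‖I * δ ^ 2 + 2 * I * δ * v * rot‖ ≤ δ ^ 2 + 2 * |δ| * |v| := by
    refine (norm_add_le _ _).trans (le_of_eq ?_)
    simp
  have h' := (abs_le.1 ((abs_re_le_norm _).trans h)).1
  nlinarith

/-! ### The line integral compared with the Gaussian. -/

/-- `Re + Im` is constant along the line, so the line misses `η` by the real offset `N + 1/2 - (X +
y)`, of modulus at most `1/2` when `N ≤ X + y ≤ N + 1`. -/
theorem line_eq_saddle_add (η : ℂ) (N : ℕ) (v : ℝ) :
    (N : ℂ) + 1 / 2 + v * rot =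
      η + (((N + 1 / 2 - (η.re + η.im) : ℝ) : ℂ) + ((v + √2 * η.im : ℝ) : ℂ) * rot) := by
  have h2 : ((√2 : ℝ) : ℂ) ^ 2 = 2 := by
    exact_mod_cast Real.sq_sqrt (show (0 : ℝ) ≤ 2 by norm_num)
  conv_rhs => rw [← re_add_im η]
  rw [rot_eq]
  push_cast
  simp only [add_re, ofReal_re, mul_re, I_re, mul_zero, ofReal_im, I_im, mul_one, sub_self, add_zero,
    add_im, mul_im, zero_add]
  linear_combination (-(η.im : ℂ) / 2 + (η.im : ℂ) * I / 2) * h2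

/-- Cubic phase error times Gaussian decay in `w = v + √2 y`, divided by the sine. Near `w = 0` the
sine has size `e^{πy}`, which supplies the factor `e^{-πy}` that the main term also has. -/
theorem norm_line_diff_le {η : ℂ} (hy : 0 < η.im) (hX : 1 ≤ η.re) {N : ℕ}
    (hN1 : (N : ℝ) ≤ η.re + η.im) (hN2 : η.re + η.im ≤ N + 1) (v : ℝ) :
    ‖(exp (logRatio η (N + 1 / 2 + v * rot)) - saddleGauss η (N + 1 / 2 + v * rot)) /
      (2 * I * sin (π * (N + 1 / 2 + v * rot))) * rot‖ ≤
      32 * π * Real.exp 246 / η.re * Real.exp (-(π * η.im)) *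
        Real.exp (-(v + √2 * η.im) ^ 2) := by
  have hπ := Real.pi_pos
  have hπ3 := Real.pi_gt_three
  have hπ4 := Real.pi_lt_d2
  have hs2 := Real.sq_sqrt (show (0 : ℝ) ≤ 2 by norm_num)
  have hsp : 0 < √2 := by positivity
  have hs15 : √2 < 1.5 := by nlinarith
  set δ : ℝ := N + 1 / 2 - (η.re + η.im) with hδ
  set w : ℝ := v + √2 * η.im with hw
  have hδabs : |δ| ≤ 1 / 2 := by rw [abs_le]; constructor <;> linarith
  have hx := line_eq_saddle_add η N v
  rw [← hδ, ← hw] at hx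
  have hsin := half_cosh_le_norm_sin_line N v
  rw [Int.cast_natCast] at hsin
  rw [norm_mul, norm_rot, mul_one, norm_div, norm_mul, norm_mul, norm_I, Complex.norm_ofNat, mul_one]
  have hcosh : Real.exp (π * η.im - π * |w|) / 2 ≤ 2 * ‖sin (π * ((N : ℂ) + 1 / 2 + v * rot))‖ := by
    refine le_trans ?_ (mul_le_mul_of_nonneg_left hsin (by norm_num))
    rw [← Real.cosh_abs, Real.cosh_eq]
    have h1 : Real.exp (π * η.im - π * |w|) ≤ Real.exp |π * (√2 / 2) * v| := by
      rw [Real.exp_le_exp, abs_mul, abs_of_pos (by positivity : 0 < π * (√2 / 2))]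
      have h2 : √2 * η.im - |w| ≤ |v| := by
        have : |√2 * η.im| ≤ |w| + |v| := by
          rw [show √2 * η.im = w - v by rw [hw]; ring]; exact abs_sub w v
        rw [abs_of_pos (by positivity)] at this
        linarith
      have h3 : η.im - |w| ≤ √2 / 2 * |v| := by
        have h4 : √2 / 2 * (√2 * η.im - |w|) ≤ √2 / 2 * |v| := by gcongr
        have h5 : √2 / 2 * (√2 * η.im - |w|) = η.im - √2 / 2 * |w| := by
          linear_combination (η.im / 2) * hs2
        nlinarith [abs_nonneg w]
      nlinarith
    have := Real.exp_pos (-|π * (√2 / 2) * v|)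
    linarith
  have hxsum : (η + ((δ : ℂ) + w * rot)).re + (η + ((δ : ℂ) + w * rot)).im =
      η.re + η.im + δ := by
    simp; ring
  have hdiff := norm_exp_logRatio_sub_le (η := η) (d := (δ : ℂ) + w * rot) (by linarith)
    (by rw [hxsum]; linarith [(abs_le.1 hδabs).1])
  set B : ℝ := Real.exp (-(π * w ^ 2 / 2) + 5 * π * (1 / 4 + |w|)) with hB
  have hδ2 : δ ^ 2 + 2 * |δ| * |w| ≤ 1 / 4 + |w| := by
    have : δ ^ 2 ≤ 1 / 4 := by rw [← sq_abs]; nlinarith [abs_nonneg δ]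
    nlinarith [abs_nonneg w]
  have hδ0 : 0 ≤ δ ^ 2 + 2 * |δ| * |w| := by positivity
  have hb1 : ‖exp (logRatio η (η + ((δ : ℂ) + w * rot)))‖ ≤ B := by
    rw [norm_exp, hB, Real.exp_le_exp]
    refine (re_logRatio_le (by linarith) hy.le (by linarith) hδabs).trans ?_
    gcongr
  have hb2 : ‖saddleGauss η (η + ((δ : ℂ) + w * rot))‖ ≤ B := by
    refine (norm_saddleGauss_le η).trans ?_
    rw [hB, Real.exp_le_exp]
    nlinarith [sq_nonneg w]
  have hd : ‖(δ : ℂ) + w * rot‖ ^ 3 ≤ Real.exp (3 * |w|) := by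
    have h1 : ‖(δ : ℂ) + w * rot‖ ≤ Real.exp |w| := by
      refine (norm_add_le _ _).trans ?_
      rw [norm_mul, norm_rot, mul_one, norm_real, norm_real, Real.norm_eq_abs, Real.norm_eq_abs]
      linarith [Real.add_one_le_exp |w|]
    calc _ ≤ Real.exp |w| ^ 3 := by gcongr
      _ = _ := by rw [← Real.exp_nat_mul]; norm_num
  rw [← hx] at hdiff hb1 hb2
  have hXpos : 0 < η.re := by linarith
  have hnum : ‖exp (logRatio η (N + 1 / 2 + v * rot)) - saddleGauss η (N + 1 / 2 + v * rot)‖ ≤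
      8 * π * Real.exp (3 * |w|) / η.re * (B + B) := by
    refine hdiff.trans ?_
    gcongr
    linarith
  calc _ ≤ 8 * π * Real.exp (3 * |w|) / η.re * (B + B) / (Real.exp (π * η.im - π * |w|) / 2) :=
        div_le_div₀ (by positivity) hnum (by positivity) hcosh
    _ = 32 * π / η.re * (Real.exp (3 * |w|) * B * Real.exp (-(π * η.im - π * |w|))) := by
        rw [Real.exp_neg]; field_simp; ring
    -- The exponent needs `(π/2 - 1)w² - (3 + 6π)|w| - 5π/4 + 246 ≥ 0`; comparison with `(|w| -
    -- 22)²/2` takes `242`, and `5π/4 < 4`.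
    _ ≤ 32 * π / η.re * (Real.exp 246 * Real.exp (-(π * η.im)) * Real.exp (-w ^ 2)) := by
        refine mul_le_mul_of_nonneg_left ?_ (by positivity)
        rw [hB, ← Real.exp_add, ← Real.exp_add, ← Real.exp_add, ← Real.exp_add, Real.exp_le_exp]
        have hw0 := abs_nonneg w
        rw [← sq_abs w]
        nlinarith [sq_nonneg (|w| - 22)]
    _ = _ := by ring

theorem integrable_exp_neg_add_sq (b : ℝ) : Integrable fun v : ℝ => Real.exp (-(v + b) ^ 2) :=
  integrable_exp_neg_sq.comp_add_right b

theorem integral_exp_neg_add_sq (b : ℝ) : ∫ v : ℝ, Real.exp (-(v + b) ^ 2) = √π := by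
  rw [integral_add_right_eq_self (fun v : ℝ => Real.exp (-v ^ 2)) b]
  simpa using integral_gaussian 1

theorem integrable_saddleGauss_line (η : ℂ) (N : ℕ) :
    Integrable fun v : ℝ => saddleGauss η (N + 1 / 2 + v * rot) /
      (2 * I * sin (π * (N + 1 / 2 + v * rot))) * rot := by
  have h := (integrable_quad_div_sin one_le_two (2 * η) N).const_mul (exp (-(2 * π * I * η ^ 2)))
  refine h.congr (Eventually.of_forall fun v => ?_)
  simp only [Int.cast_natCast]
  rw [saddleGauss_eq]
  ring

/-- Replacing the integrand by the Gaussian at the saddle point, on the line of integration. -/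
theorem norm_lineInt_sub_le {η : ℂ} (hy : 0 < η.im) (hX : 1 ≤ η.re) {N : ℕ}
    (hN1 : (N : ℝ) ≤ η.re + η.im) (hN2 : η.re + η.im ≤ N + 1) :
    ‖lineInt (fun x => exp (logRatio η x)) (N + 1 / 2) - lineInt (saddleGauss η) (N + 1 / 2)‖ ≤
      32 * π * Real.exp 246 / η.re * Real.exp (-(π * η.im)) * √π := by
  have hbound := norm_line_diff_le hy hX hN1 hN2
  have hgi := (integrable_exp_neg_add_sq (√2 * η.im)).const_mul
    (32 * π * Real.exp 246 / η.re * Real.exp (-(π * η.im)))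
  have hmem : ∀ v : ℝ, (N : ℂ) + 1 / 2 + v * rot ∈ slitPlane := fun v => by
    apply mem_slitPlane_of_re_add_im_pos
    have : ((N : ℂ) + 1 / 2 + v * rot).re + ((N : ℂ) + 1 / 2 + v * rot).im = N + 1 / 2 := by
      simp
    rw [this]; positivity
  have hdi : Integrable fun v : ℝ =>
      (exp (logRatio η (N + 1 / 2 + v * rot)) - saddleGauss η (N + 1 / 2 + v * rot)) /
      (2 * I * sin (π * (N + 1 / 2 + v * rot))) * rot := by
    refine Integrable.mono' hgi (Continuous.aestronglyMeasurable ?_) (Eventually.of_forall hbound)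
    refine Continuous.mul (Continuous.div ?_ (by fun_prop) fun v => ?_) continuous_const
    · unfold logRatio saddleGauss
      have hlog : Continuous fun v : ℝ => log ((N : ℂ) + 1 / 2 + v * rot) :=
        Continuous.clog (by fun_prop) hmem
      fun_prop
    · have := sin_line_ne_zero N v
      rw [Int.cast_natCast] at this
      exact mul_ne_zero (mul_ne_zero two_ne_zero I_ne_zero) this
  have hhi : Integrable fun v : ℝ => exp (logRatio η (N + 1 / 2 + v * rot)) /
      (2 * I * sin (π * (N + 1 / 2 + v * rot))) * rot := by
    refine (hdi.add (integrable_saddleGauss_line η N)).congr (Eventually.of_forall fun v => ?_)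
    simp only [Pi.add_apply]
    ring
  rw [lineInt, lineInt, ← integral_sub hhi (integrable_saddleGauss_line η N)]
  have h := norm_integral_le_of_norm_le hgi (Eventually.of_forall hbound)
  rw [integral_const_mul, integral_exp_neg_add_sq] at h
  refine le_trans (le_of_eq ?_) h
  congr 2; ext v; ring

/-! ### The tail of the series compared with the Gaussian. -/

/-- At real points `e^{-πi x²}` is unimodular, and only the power of exponent `Re(2πi η²) = -4πXy`
changes the modulus. -/
theorem re_logRatio_ofReal (η : ℂ) {x₁ x₂ : ℝ} (h1 : 0 < x₁) (h2 : 0 < x₂) :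
    (logRatio η x₂).re = (logRatio η x₁).re - 4 * π * η.re * η.im * Real.log (x₂ / x₁) := by
  have e : logRatio η x₂ = logRatio η x₁ +
      ((2 * π * Real.log (x₂ / x₁) : ℝ) : ℂ) * (I * η ^ 2) - ((π * (x₂ ^ 2 - x₁ ^ 2) : ℝ) : ℂ) * I := by
    rw [logRatio, logRatio, ← ofReal_log h1.le, ← ofReal_log h2.le, Real.log_div h2.ne' h1.ne']
    push_cast; ring
  rw [e, sub_re, add_re, re_ofReal_mul, re_ofReal_mul]
  have : (I * η ^ 2).re = -(2 * η.re * η.im) := by simp [sq]; ring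
  rw [this, I_re]
  ring

/-- The integrand at real points to the right of the line of steepest descent. -/
theorem norm_exp_logRatio_real_le {η : ℂ} (hy : 0 < η.im) (hyX : η.im ≤ η.re) (hX : 1 ≤ η.re)
    (hm : 5 ≤ 4 * π * η.re * η.im) {n : ℝ} (hn : η.re + η.im ≤ n) :
    ‖exp (logRatio η n)‖ ≤ Real.exp (-(π * η.im * (n - η.re))) +
      32 * Real.exp 3 * Real.exp (-(2 * π * η.re * η.im)) * (η.re / n) ^ 5 := by
  have hπ := Real.pi_pos
  set X := η.re
  set y := η.im
  have hx0 : 0 < X + y := by linarith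
  have hn0 : 0 < n := by linarith
  -- The descent line through `η` itself meets the real axis at `X + y`, for `v = √2 y`.
  have hbase : (logRatio η ((X + y : ℝ) : ℂ)).re ≤ -(π * y ^ 2) := by
    have h := re_logRatio_le (η := η) (δ := 0) (v := √2 * y) (by linarith : 0 ≤ X) hy.le
      (by linarith : 1 ≤ X + y) (by norm_num)
    have e : η + (((0 : ℝ) : ℂ) + ((√2 * y : ℝ) : ℂ) * rot) = ((X + y : ℝ) : ℂ) := by
      have h2 : ((√2 : ℝ) : ℂ) ^ 2 = 2 := by
        exact_mod_cast Real.sq_sqrt (show (0 : ℝ) ≤ 2 by norm_num)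
      conv_lhs => rw [← re_add_im η]
      rw [rot_eq]
      push_cast
      linear_combination ((y : ℂ) / 2 - (y : ℂ) * I / 2) * h2
    rw [e, mul_pow, Real.sq_sqrt (by norm_num)] at h
    simp only [abs_zero] at h
    linarith
  have hreal := re_logRatio_ofReal η hx0 hn0
  rw [norm_exp]
  set ℓ := Real.log (n / (X + y)) with hℓ
  -- Up to `4X` the logarithm is bounded below linearly, giving exponential decay. Beyond, of the
  -- exponent `4πXy ≥ 5` five units become `(X/n)⁵` and half of the rest becomes `e^{-2πXy}`. The
  -- fifth power leaves `n⁻²` after the cubic error factor.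
  rcases le_total n (4 * X) with h4 | h4
  · have hlog : 1 - (X + y) / n ≤ ℓ := by
      have := Real.one_sub_inv_le_log_of_pos (show 0 < n / (X + y) by positivity)
      rwa [inv_div] at this
    have h5 : π * y * (n - X - y) ≤ 4 * π * X * y * ℓ := by
      have h6 : (n - X - y) / (4 * X) ≤ ℓ := by
        refine le_trans ?_ hlog
        rw [show 1 - (X + y) / n = (n - X - y) / n by field_simp; ring]
        apply div_le_div_of_nonneg_left (by linarith) hn0 h4
      rw [div_le_iff₀ (by linarith)] at h6
      have : 0 < π * y := by positivity
      nlinarith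
    have h7 : (logRatio η n).re ≤ -(π * y * (n - X)) := by
      rw [hreal]; nlinarith
    have h8 := Real.exp_le_exp.2 h7
    have : 0 ≤ 32 * Real.exp 3 * Real.exp (-(2 * π * X * y)) * (X / n) ^ 5 := by positivity
    linarith
  · have h2 : 2 ≤ n / (X + y) := by rw [le_div_iff₀ hx0]; linarith
    have hlog2 : 1 / 2 ≤ ℓ := by
      have h3 := Real.log_le_log (by norm_num) h2
      have := Real.log_two_gt_d9
      linarith
    have hlog5 : Real.log (n / (2 * X)) ≤ ℓ := by
      apply Real.log_le_log (by positivity)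
      apply div_le_div_of_nonneg_left hn0.le hx0 (by linarith)
    have h7 : (logRatio η n).re ≤ 3 + -(2 * π * X * y) + -(5 * Real.log (n / (2 * X))) := by
      rw [hreal]
      nlinarith [sq_nonneg y]
    have h8 := Real.exp_le_exp.2 h7
    rw [Real.exp_add, Real.exp_add] at h8
    have h9 : Real.exp (-(5 * Real.log (n / (2 * X)))) = 32 * (X / n) ^ 5 := by
      rw [Real.exp_neg, show (5 : ℝ) * Real.log (n / (2 * X)) = ((5 : ℕ) : ℝ) * Real.log (n / (2 * X))
        by norm_num, Real.exp_nat_mul, Real.exp_log (by positivity)]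
      field_simp
      norm_num
    rw [h9] at h8
    have := Real.exp_pos (-(π * y * (n - X)))
    linarith

theorem two_thirds_mul_le_one_sub_exp {a : ℝ} (h0 : 0 < a) (h1 : a ≤ 1) :
    2 / 3 * a ≤ 1 - Real.exp (-(2 * a)) := by
  have h2 : Real.exp (-(2 * a)) ≤ 1 / (1 + 2 * a) := by
    rw [Real.exp_neg, one_div]
    apply inv_anti₀ (by linarith)
    linarith [Real.add_one_le_exp (2 * a)]
  have h3 : 1 / (1 + 2 * a) ≤ 1 - 2 / 3 * a := by
    rw [div_le_iff₀ (by linarith)]; nlinarith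
  linarith

theorem pow_le_factorial_mul_exp {z : ℝ} (hz : 0 ≤ z) (k : ℕ) : z ^ k ≤ k.factorial * Real.exp z := by
  have := Real.pow_div_factorial_le_exp z hz k
  rwa [div_le_iff₀' (by positivity)] at this

/-- The cube costs `a⁻³ e^{aD}`. From `aD + y ≤ yD + 1` one recovers `e^{-πy}` and still has `(π -
1)aD ≥ 2ak` for a geometric series. -/
theorem cube_mul_exp_le {y D : ℝ} {k : ℕ} (hy : 0 < y) (hD : y + k ≤ D) :
    D ^ 3 * Real.exp (-(π * y * D)) ≤
      6 * Real.exp π * Real.exp (-(π * y)) / (min y 1) ^ 3 * Real.exp (-(2 * min y 1)) ^ k := by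
  have hπ := Real.pi_gt_three
  have hk : (0 : ℝ) ≤ k := k.cast_nonneg
  have hD0 : 0 < D := by linarith
  set a := min y 1 with ha
  have ha0 : 0 < a := lt_min hy one_pos
  have h1 : a * D + y ≤ y * D + 1 := by
    rcases le_total y 1 with h | h
    · rw [ha, min_eq_left h]; linarith
    · rw [ha, min_eq_right h]; nlinarith
  have h2 : a ^ 3 * D ^ 3 ≤ 6 * Real.exp (a * D) := by
    rw [← mul_pow]
    simpa [Nat.factorial] using pow_le_factorial_mul_exp (by positivity : 0 ≤ a * D) 3
  have h3 : Real.exp (a * D) * Real.exp (-(π * y * D)) ≤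
      Real.exp π * Real.exp (-(π * y)) * Real.exp (-(2 * a)) ^ k := by
    rw [← Real.exp_nat_mul, ← Real.exp_add, ← Real.exp_add, ← Real.exp_add, Real.exp_le_exp]
    have h4 : a * k ≤ a * D := by gcongr; linarith
    nlinarith [mul_pos ha0 hD0]
  rw [div_mul_eq_mul_div, le_div_iff₀ (by positivity)]
  calc D ^ 3 * Real.exp (-(π * y * D)) * a ^ 3 = a ^ 3 * D ^ 3 * Real.exp (-(π * y * D)) := by ring
    _ ≤ 6 * Real.exp (a * D) * Real.exp (-(π * y * D)) := by gcongr
    _ = 6 * (Real.exp (a * D) * Real.exp (-(π * y * D))) := by ring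
    _ ≤ 6 * (Real.exp π * Real.exp (-(π * y)) * Real.exp (-(2 * a)) ^ k) := by gcongr
    _ = _ := by ring

/-- `X a² ≥ 1` gives `X⁵ a⁴ ≤ (Xa)⁶ ≤ 720 e^{Xa}`, and `2πXy ≥ Xa + πy`. -/
theorem pow_five_mul_exp_le {X y : ℝ} (hy : 0 < y) (hX : 1 ≤ X) (h : 1 ≤ X * (min y 1) ^ 2) :
    X ^ 5 * Real.exp (-(2 * π * X * y)) ≤ 720 * Real.exp (-(π * y)) / (min y 1) ^ 4 := by
  have hπ := Real.pi_gt_three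
  set a := min y 1 with ha
  have ha0 : 0 < a := lt_min hy one_pos
  have hay : a ≤ y := min_le_left _ _
  have h2 : (X * a) ^ 6 ≤ 720 * Real.exp (X * a) := by
    simpa [Nat.factorial] using pow_le_factorial_mul_exp (by positivity : 0 ≤ X * a) 6
  have h3 : X ^ 5 * a ^ 4 ≤ (X * a) ^ 6 := by
    calc X ^ 5 * a ^ 4 = X ^ 5 * a ^ 4 * 1 := by ring
      _ ≤ X ^ 5 * a ^ 4 * (X * a ^ 2) := by gcongr
      _ = _ := by ring
  have h4 : Real.exp (X * a) * Real.exp (-(2 * π * X * y)) ≤ Real.exp (-(π * y)) := by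
    rw [← Real.exp_add, Real.exp_le_exp]
    have h5 : X * a ≤ X * y := by gcongr
    have h6 : y ≤ X * y := by nlinarith
    have h7 : 0 < X * y := by positivity
    nlinarith
  rw [le_div_iff₀ (by positivity)]
  calc X ^ 5 * Real.exp (-(2 * π * X * y)) * a ^ 4 =
        X ^ 5 * a ^ 4 * Real.exp (-(2 * π * X * y)) := by ring
    _ ≤ 720 * Real.exp (X * a) * Real.exp (-(2 * π * X * y)) :=
        mul_le_mul_of_nonneg_right (h3.trans h2) (Real.exp_pos _).le
    _ = 720 * (Real.exp (X * a) * Real.exp (-(2 * π * X * y))) := by ring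
    _ ≤ _ := by gcongr

theorem norm_saddleGauss_ofReal (η : ℂ) (n : ℝ) :
    ‖saddleGauss η n‖ = Real.exp (-(4 * π * η.im * (n - η.re))) := by
  rw [saddleGauss, norm_exp]
  congr 1
  have e : -(2 * π * I * ((n : ℂ) - η) ^ 2) = ((2 * π : ℝ) : ℂ) * (-I * ((n : ℂ) - η) ^ 2) := by
    push_cast; ring
  rw [e, re_ofReal_mul]
  simp [sq]
  ring

/-- The `k`-th term of the difference of the two tails. -/
theorem norm_tail_term_le {η : ℂ} (hy : 0 < η.im) (hyX : η.im ≤ η.re) (hX : 1 ≤ η.re)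
    (h : 1 ≤ η.re * (min η.im 1) ^ 2) {N : ℕ} (hN : η.re + η.im ≤ N + 1) (k : ℕ) :
    ‖exp (logRatio η ((N + 1 + k : ℕ) : ℂ)) - saddleGauss η ((N + 1 + k : ℕ) : ℂ)‖ ≤
      64 * π / η.re * (12 * Real.exp π * Real.exp (-(π * η.im)) / (min η.im 1) ^ 3 *
          Real.exp (-(2 * min η.im 1)) ^ k +
        23040 * Real.exp 3 * Real.exp (-(π * η.im)) / (min η.im 1) ^ 4 *
          (1 / ((k : ℝ) + 1) ^ 2)) := by
  have hπ := Real.pi_gt_three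
  set X := η.re with hXd
  set y := η.im with hyd
  set a := min y 1 with ha
  have ha0 : 0 < a := lt_min hy one_pos
  have hay : a ≤ y := min_le_left _ _
  have ha1 : a ≤ 1 := min_le_right _ _
  have hk : (0 : ℝ) ≤ k := k.cast_nonneg
  set n : ℝ := ((N + 1 + k : ℕ) : ℝ) with hn
  have hnC : ((N + 1 + k : ℕ) : ℂ) = (n : ℂ) := by rw [hn]; push_cast; ring
  have hn' : n = N + 1 + k := by rw [hn]; push_cast; ring
  rw [hnC]
  set D : ℝ := n - X with hD
  have hDk : y + k ≤ D := by linarith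
  have hD0 : 0 < D := by linarith
  have hnk : (k : ℝ) + 1 ≤ n := by
    have : (0 : ℝ) ≤ N := N.cast_nonneg
    linarith
  have hm : 5 ≤ 4 * π * X * y := by
    have h1 : 1 ≤ X * y := by
      calc 1 ≤ X * a ^ 2 := h
        _ ≤ X * y := by
          have : a ^ 2 ≤ y := by nlinarith
          gcongr
    nlinarith
  have hb1 := norm_exp_logRatio_real_le hy hyX hX hm (n := n) (by linarith)
  have hb2 : ‖saddleGauss η n‖ ≤ Real.exp (-(π * y * D)) := by
    rw [norm_saddleGauss_ofReal, Real.exp_le_exp]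
    have : 0 < π * y * D := by positivity
    rw [← hyd, ← hXd, ← hD]
    linarith
  have hdiff := norm_exp_logRatio_sub_le (η := η) (d := (n : ℂ) - η) (by linarith) (by
    simp only [add_sub_cancel, ofReal_re, ofReal_im]; linarith)
  rw [add_sub_cancel] at hdiff
  have hd : ‖(n : ℂ) - η‖ ≤ 2 * D := by
    have h1 := norm_le_abs_re_add_abs_im ((n : ℂ) - η)
    rw [sub_re, sub_im, ofReal_re, ofReal_im, ← hXd, ← hyd, ← hD, zero_sub, abs_neg,
      abs_of_pos hD0, abs_of_pos hy] at h1
    linarith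
  have hpow : (X / n) ^ 5 * D ^ 3 ≤ X ^ 5 * (1 / ((k : ℝ) + 1) ^ 2) := by
    have hn0 : 0 < n := by linarith
    have hDn : D ≤ n := by linarith
    calc (X / n) ^ 5 * D ^ 3 ≤ (X / n) ^ 5 * n ^ 3 := by gcongr
      _ = X ^ 5 * (1 / n ^ 2) := by field_simp
      _ ≤ _ := by gcongr
  have hc1 := cube_mul_exp_le hy hDk
  have hc2 := pow_five_mul_exp_le hy hX h
  rw [← ha] at hc1 hc2
  calc _ ≤ 8 * π * ‖(n : ℂ) - η‖ ^ 3 / (X + y) *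
        (‖exp (logRatio η n)‖ + ‖saddleGauss η n‖) := hdiff
    _ ≤ 8 * π * (2 * D) ^ 3 / X * (Real.exp (-(π * y * D)) +
        32 * Real.exp 3 * Real.exp (-(2 * π * X * y)) * (X / n) ^ 5 + Real.exp (-(π * y * D))) := by
      gcongr
      linarith
    _ = 64 * π / X * (2 * (D ^ 3 * Real.exp (-(π * y * D))) +
        32 * Real.exp 3 * Real.exp (-(2 * π * X * y)) * ((X / n) ^ 5 * D ^ 3)) := by ring
    _ ≤ 64 * π / X * (2 * (6 * Real.exp π * Real.exp (-(π * y)) / a ^ 3 * Real.exp (-(2 * a)) ^ k) +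
        32 * Real.exp 3 * Real.exp (-(2 * π * X * y)) * (X ^ 5 * (1 / ((k : ℝ) + 1) ^ 2))) := by
      gcongr
    _ = 64 * π / X * (12 * Real.exp π * Real.exp (-(π * y)) / a ^ 3 * Real.exp (-(2 * a)) ^ k +
        32 * Real.exp 3 * (X ^ 5 * Real.exp (-(2 * π * X * y))) * (1 / ((k : ℝ) + 1) ^ 2)) := by
      ring
    _ ≤ 64 * π / X * (12 * Real.exp π * Real.exp (-(π * y)) / a ^ 3 * Real.exp (-(2 * a)) ^ k +
        32 * Real.exp 3 * (720 * Real.exp (-(π * y)) / a ^ 4) * (1 / ((k : ℝ) + 1) ^ 2)) := by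
      gcongr
    _ = _ := by ring

theorem hasSum_inv_succ_sq :
    HasSum (fun k : ℕ => 1 / ((k : ℝ) + 1) ^ 2) (∑' k : ℕ, 1 / ((k : ℝ) + 1) ^ 2) := by
  have h1 : Summable fun n : ℕ => 1 / (n : ℝ) ^ 2 := Real.summable_one_div_nat_pow.2 one_lt_two
  have h2 := (summable_nat_add_iff 1).2 h1
  exact (by simpa using h2 : Summable fun k : ℕ => 1 / ((k : ℝ) + 1) ^ 2).hasSum

/-- Replacing the terms of the tail by the Gaussian at the saddle point. -/
theorem exists_norm_tail_sub_le :
    ∃ K : ℝ, 0 < K ∧ ∀ η : ℂ, 0 < η.im → η.im ≤ η.re → 1 ≤ η.re → 1 ≤ η.re * (min η.im 1) ^ 2 →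
      ∀ N : ℕ, η.re + η.im ≤ N + 1 →
      (Summable fun k : ℕ => (-1) ^ (N + 1 + k) * exp (logRatio η ((N + 1 + k : ℕ) : ℂ))) ∧
      ‖(∑' k : ℕ, (-1) ^ (N + 1 + k) * exp (logRatio η ((N + 1 + k : ℕ) : ℂ))) -
        ∑' k : ℕ, (-1) ^ (N + 1 + k) * saddleGauss η ((N + 1 + k : ℕ) : ℂ)‖ ≤
          K * Real.exp (-(π * η.im)) / (η.re * (min η.im 1) ^ 4) := by
  set Z : ℝ := ∑' k : ℕ, 1 / ((k : ℝ) + 1) ^ 2 with hZ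
  have hZ0 : 0 ≤ Z := tsum_nonneg fun k => by positivity
  -- `18 = 12 · 3/2` from the geometric sum, at most `3/(2a)`, which raises `a⁻³` to `a⁻⁴`.
  refine ⟨64 * π * (18 * Real.exp π + 23040 * Real.exp 3 * Z), by positivity, ?_⟩
  intro η hy hyX hX h N hN
  set a := min η.im 1 with ha
  have ha0 : 0 < a := lt_min hy one_pos
  have ha1 : a ≤ 1 := min_le_right _ _
  have hX0 : 0 < η.re := by linarith
  have hq := two_thirds_mul_le_one_sub_exp ha0 ha1
  have hq1 : Real.exp (-(2 * a)) < 1 := by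
    have : 0 < 2 / 3 * a := by positivity
    linarith
  have hgeo := hasSum_geometric_of_lt_one (Real.exp_pos (-(2 * a))).le hq1
  have hsum := (((hgeo.mul_left (12 * Real.exp π * Real.exp (-(π * η.im)) / a ^ 3)).add
    (hasSum_inv_succ_sq.mul_left (23040 * Real.exp 3 * Real.exp (-(π * η.im)) / a ^ 4))).mul_left
      (64 * π / η.re))
  have hbound : ∀ k : ℕ, ‖(-1) ^ (N + 1 + k) * exp (logRatio η ((N + 1 + k : ℕ) : ℂ)) -
      (-1) ^ (N + 1 + k) * saddleGauss η ((N + 1 + k : ℕ) : ℂ)‖ ≤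
      64 * π / η.re * (12 * Real.exp π * Real.exp (-(π * η.im)) / a ^ 3 * Real.exp (-(2 * a)) ^ k +
        23040 * Real.exp 3 * Real.exp (-(π * η.im)) / a ^ 4 * (1 / ((k : ℝ) + 1) ^ 2)) := fun k => by
    rw [← mul_sub, norm_mul, norm_pow, norm_neg, norm_one, one_pow, one_mul]
    exact norm_tail_term_le hy hyX hX h hN k
  have hdS := Summable.of_norm_bounded hsum.summable hbound
  have hgS := (hasSum_saddleGauss hy N).summable
  have hhS : Summable fun k : ℕ => (-1) ^ (N + 1 + k) * exp (logRatio η ((N + 1 + k : ℕ) : ℂ)) :=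
    (hdS.add hgS).congr fun k => by ring
  refine ⟨hhS, ?_⟩
  rw [← hhS.tsum_sub hgS]
  refine (tsum_of_norm_bounded hsum hbound).trans ?_
  have hinv : (1 - Real.exp (-(2 * a)))⁻¹ ≤ 3 / (2 * a) := by
    rw [show 3 / (2 * a) = (2 / 3 * a)⁻¹ by field_simp]
    exact inv_anti₀ (by positivity) hq
  calc _ ≤ 64 * π / η.re * (12 * Real.exp π * Real.exp (-(π * η.im)) / a ^ 3 * (3 / (2 * a)) +
        23040 * Real.exp 3 * Real.exp (-(π * η.im)) / a ^ 4 * Z) := by gcongr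
    _ = _ := by field_simp; ring

/-! ### Lower bound for the main term. -/

/-- `|sin πη| ≥ sinh πy ≥ e^{πy} a/3` and `|cos 2πη| ≤ e^{2πy}`. The factor `a` reflects the real
zeros of the sine and costs the fifth power of `a` in the relative error. -/
theorem le_norm_saddle_value {η : ℂ} (hy : 0 < η.im) :
    min η.im 1 * Real.exp (-(π * η.im)) / 6 ≤
      ‖(√2 : ℂ) * exp (3 * π * I / 8) * sin (π * η) / (2 * cos (2 * π * η))‖ := by
  have hπ := Real.pi_gt_three
  set y := η.im with hyd
  set a := min y 1 with ha
  have ha0 : 0 < a := lt_min hy one_pos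
  have hay : a ≤ y := min_le_left _ _
  have hq := two_thirds_mul_le_one_sub_exp ha0 (min_le_right _ _)
  have hsin : Real.exp (π * y) * a / 3 ≤ ‖sin (π * η)‖ := by
    refine le_trans ?_ ((le_abs_self _).trans (abs_sinh_im_le_norm_sin _))
    rw [im_ofReal_mul, ← hyd, Real.sinh_eq]
    have h1 : Real.exp (-(π * y)) ≤ Real.exp (π * y) * Real.exp (-(2 * a)) := by
      rw [← Real.exp_add, Real.exp_le_exp]; nlinarith
    have h2 := mul_le_mul_of_nonneg_left hq (Real.exp_pos (π * y)).le
    linarith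
  have hcos : ‖cos (2 * π * η)‖ ≤ Real.exp (2 * π * y) := by
    have h1 : ‖cos (2 * π * η)‖ ≤ Real.cosh (2 * π * y) := by
      apply le_of_sq_le_sq _ (Real.cosh_pos _).le
      rw [sq_norm_cos]
      have : (2 * π * η).im = 2 * π * y := by simp [hyd]
      rw [this]
      nlinarith [sq_nonneg (Real.sin (2 * π * η).re)]
    refine h1.trans ?_
    rw [Real.cosh_eq]
    have : Real.exp (-(2 * π * y)) ≤ Real.exp (2 * π * y) := by
      rw [Real.exp_le_exp]
      have : 0 < 2 * π * y := by positivity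
      linarith
    linarith
  have hcos0 : 0 < ‖cos (2 * π * η)‖ := by
    apply norm_pos_iff.2
    intro h0
    have := sq_norm_cos (2 * π * η)
    have him : (2 * π * η).im = 2 * π * y := by simp [hyd]
    rw [h0, norm_zero, him] at this
    have h2 := Real.cosh_sq (2 * π * y)
    have h3 := Real.sin_sq_le_one (2 * π * η).re
    have h4 : 0 < Real.sinh (2 * π * y) := Real.sinh_pos_iff.2 (by positivity)
    nlinarith
  have he : ‖exp (3 * π * I / 8)‖ = 1 := by
    rw [show 3 * (π : ℂ) * I / 8 = ((3 * π / 8 : ℝ) : ℂ) * I by push_cast; ring]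
    exact norm_exp_ofReal_mul_I _
  rw [norm_div, norm_mul, norm_mul, norm_mul, he, Complex.norm_ofNat, norm_real, Real.norm_eq_abs,
    abs_of_nonneg (Real.sqrt_nonneg 2), mul_one, le_div_iff₀ (by positivity)]
  have hs1 : 1 ≤ √2 := Real.one_le_sqrt.2 (by norm_num)
  calc a * Real.exp (-(π * y)) / 6 * (2 * ‖cos (2 * π * η)‖)
      ≤ a * Real.exp (-(π * y)) / 6 * (2 * Real.exp (2 * π * y)) := by gcongr
    _ = Real.exp (π * y) * a / 3 := by
      rw [show 2 * π * y = π * y + π * y by ring, Real.exp_add, Real.exp_neg]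
      field_simp; ring
    _ ≤ ‖sin (π * η)‖ := hsin
    _ ≤ √2 * ‖sin (π * η)‖ := by nlinarith [norm_nonneg (sin (π * η))]

/-! ### The position of the saddle point and the final estimate. -/

theorem sub_one_eq_eta_sq (s : ℂ) : s - 1 = 2 * π * I * eta s ^ 2 := by
  have hπ : (π : ℂ) ≠ 0 := by exact_mod_cast Real.pi_ne_zero
  rw [eta_sq, mul_div_cancel₀]
  exact mul_ne_zero (mul_ne_zero two_ne_zero hπ) I_ne_zero

theorem one_sub_re_eq (s : ℂ) : 1 - s.re = 4 * π * (eta s).re * (eta s).im := by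
  have h := congrArg re (sub_one_eq_eta_sq s)
  have e : (2 * π * I * eta s ^ 2).re = -(4 * π * (eta s).re * (eta s).im) := by
    simp [sq]; ring
  rw [e, sub_re, one_re] at h
  linarith

theorem im_eq (s : ℂ) : s.im = 2 * π * ((eta s).re ^ 2 - (eta s).im ^ 2) := by
  have h := congrArg im (sub_one_eq_eta_sq s)
  have e : (2 * π * I * eta s ^ 2).im = 2 * π * ((eta s).re ^ 2 - (eta s).im ^ 2) := by
    simp [sq]
  rw [e, sub_im, one_im, sub_zero] at h
  exact h

/-- `σ < 1` gives `Xy > 0`, the choice of the root excludes the third quadrant, and `t > 0` gives `X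
> y`. -/
theorem eta_pos {s : ℂ} (ht : 0 < s.im) (hσ : s.re < 1) :
    0 < (eta s).im ∧ (eta s).im < (eta s).re := by
  have hπ := Real.pi_pos
  have harg := arg_eta s (by
    rw [mem_slitPlane_iff]; left; simpa using hσ)
  have h1 : 0 ≤ (eta s).re ∨ 0 ≤ (eta s).im :=
    neg_pi_div_two_le_arg_iff.1 (by have := harg.1; linarith)
  have h2 := one_sub_re_eq s
  have h3 : 0 < (eta s).re * (eta s).im := by
    have : 0 < 4 * π * ((eta s).re * (eta s).im) := by linarith
    exact pos_of_mul_pos_right this (by positivity)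
  have h4 : 0 < (eta s).re ∧ 0 < (eta s).im := by
    rcases pos_and_pos_or_neg_and_neg_of_mul_pos h3 with h | h
    · exact h
    · rcases h1 with h1 | h1 <;> linarith [h.1, h.2]
  refine ⟨h4.2, ?_⟩
  have h5 := im_eq s
  have h6 : 0 < (eta s).re ^ 2 - (eta s).im ^ 2 := by
    have : 0 < 2 * π * ((eta s).re ^ 2 - (eta s).im ^ 2) := by linarith
    exact pos_of_mul_pos_right this (by positivity)
  exact lt_of_pow_lt_pow_left₀ 2 h4.1.le (by linarith)

theorem powGauss_eq {s x : ℂ} (hη : eta s ≠ 0) (hx : x ≠ 0) :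
    powGauss s x = eta s ^ (s - 1) * exp (-(π * I * eta s ^ 2)) * exp (logRatio (eta s) x) := by
  rw [powGauss, cpow_def_of_ne_zero hx, cpow_def_of_ne_zero hη, ← Complex.exp_add,
    ← Complex.exp_add, ← Complex.exp_add, logRatio, sub_one_eq_eta_sq]
  congr 1; ring

theorem natCast_cpow_eq {s : ℂ} (hη : eta s ≠ 0) {n : ℕ} (hn : 0 < n) :
    (n : ℂ) ^ (s - 1) = eta s ^ (s - 1) * exp (-(π * I * eta s ^ 2)) *
      ((-1) ^ n * exp (logRatio (eta s) n)) := by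
  have h := powGauss_eq (s := s) hη (x := n) (by exact_mod_cast hn.ne')
  rw [powGauss] at h
  linear_combination (-1) ^ n * h - (n : ℂ) ^ (s - 1) * neg_one_pow_mul_exp_sq n

/-- The representation of `auxR` relative to the saddle point. -/
theorem auxR_eq_saddle {s : ℂ} (hs : s.re < -1) (hη : eta s ≠ 0) (N : ℕ) :
    auxR s = chi s * (eta s ^ (s - 1) * exp (-(π * I * eta s ^ 2))) *
      ((∑' k : ℕ, (-1) ^ (N + 1 + k) * exp (logRatio (eta s) ((N + 1 + k : ℕ) : ℂ))) -
        lineInt (fun x => exp (logRatio (eta s) x)) (N + 1 / 2)) := by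
  have h1 : ∀ k : ℕ, ((N + 1 + k : ℕ) : ℂ) ^ (s - 1) =
      eta s ^ (s - 1) * exp (-(π * I * eta s ^ 2)) *
        ((-1) ^ (N + 1 + k) * exp (logRatio (eta s) ((N + 1 + k : ℕ) : ℂ))) := fun k =>
    natCast_cpow_eq hη (by omega)
  have h2 : lineInt (powGauss s) (N + 1 / 2) = eta s ^ (s - 1) * exp (-(π * I * eta s ^ 2)) *
      lineInt (fun x => exp (logRatio (eta s) x)) (N + 1 / 2) := by
    rw [← lineInt_const_mul]
    unfold lineInt
    congr 1; ext v
    have hx : (N : ℂ) + 1 / 2 + v * rot ≠ 0 := fun h => by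
      have := rot_mul_line_re N v
      rw [h] at this; simp at this
    rw [powGauss_eq hη hx]
  rw [auxR_eq_chi_mul hs N, tsum_congr h1, tsum_mul_left, h2]
  ring

/-- The relative error in terms of the saddle point `η = X + iy` is `O(1 / (X min(y,1)⁵))`. -/
theorem exists_auxR_eq_mainTerm_mul :
    ∃ K : ℝ, 0 < K ∧ ∀ s : ℂ, 0 < s.im → s.re < -1 →
      1 ≤ (eta s).re * (min (eta s).im 1) ^ 5 →
      ∃ U : ℂ, auxR s = mainTerm s * (1 + U) ∧
        ‖U‖ ≤ K / ((eta s).re * (min (eta s).im 1) ^ 5) := by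
  have hπ := Real.pi_pos
  obtain ⟨K, hK0, hK⟩ := exists_norm_tail_sub_le
  set K' : ℝ := 32 * π * Real.exp 246 * √π with hK'
  have hK'0 : 0 < K' := by positivity
  refine ⟨6 * (K + K'), by positivity, fun s ht hs h => ?_⟩
  obtain ⟨hy, hyX⟩ := eta_pos ht (by linarith)
  have hη0 : eta s ≠ 0 := fun h0 => by rw [h0] at hy; simp at hy
  set η := eta s with hη
  set a := min η.im 1 with ha
  have ha0 : 0 < a := lt_min hy one_pos
  have ha1 : a ≤ 1 := min_le_right _ _
  have hX0 : 0 < η.re := by linarith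
  have hX1 : 1 ≤ η.re := h.trans (mul_le_of_le_one_right hX0.le (pow_le_one₀ ha0.le ha1))
  have hXa : 1 ≤ η.re * a ^ 2 := h.trans (by
    gcongr ?_ * ?_
    exact pow_le_pow_of_le_one ha0.le ha1 (by norm_num))
  -- The representation holds for every `N`; this one brings the line closest to the saddle point.
  set N : ℕ := ⌊η.re + η.im⌋₊ with hN
  have hN1 : (N : ℝ) ≤ η.re + η.im := Nat.floor_le (by linarith)
  have hN2 : η.re + η.im ≤ N + 1 := (Nat.lt_floor_add_one _).le
  obtain ⟨-, hsum⟩ := hK η hy hyX.le hX1 hXa N hN2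
  have hline := norm_lineInt_sub_le hy hX1 hN1 hN2
  have hval := saddleGauss_sum_sub_lineInt hy N
  have hlow := le_norm_saddle_value hy
  have hrep := auxR_eq_saddle hs hη0 N
  rw [← hη] at hrep
  set Q : ℂ := (√2 : ℂ) * exp (3 * π * I / 8) * sin (π * η) / (2 * cos (2 * π * η)) with hQ
  set S₁ := ∑' k : ℕ, (-1) ^ (N + 1 + k) * exp (logRatio η ((N + 1 + k : ℕ) : ℂ))
  set S₀ := ∑' k : ℕ, (-1) ^ (N + 1 + k) * saddleGauss η ((N + 1 + k : ℕ) : ℂ)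
  set J₁ := lineInt (fun x => exp (logRatio η x)) (N + 1 / 2)
  set J₀ := lineInt (saddleGauss η) (N + 1 / 2)
  have hE0 := Real.exp_pos (-(π * η.im))
  have hQ0 : 0 < ‖Q‖ := lt_of_lt_of_le (by positivity) hlow
  have hQne : Q ≠ 0 := norm_pos_iff.1 hQ0
  refine ⟨((S₁ - S₀) - (J₁ - J₀)) / (-Q), ?_, ?_⟩
  · have e : S₁ - J₁ = -Q * (1 + ((S₁ - S₀) - (J₁ - J₀)) / (-Q)) := by
      field_simp
      linear_combination hval
    rw [hrep, e, mainTerm, ← hη, ← hQ]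
    ring
  · rw [norm_div, norm_neg]
    have h4 : η.re * a ^ 4 ≤ η.re := mul_le_of_le_one_right hX0.le (pow_le_one₀ ha0.le ha1)
    have herr : ‖(S₁ - S₀) - (J₁ - J₀)‖ ≤
        (K + K') * Real.exp (-(π * η.im)) / (η.re * a ^ 4) := by
      refine (norm_sub_le _ _).trans ?_
      rw [add_mul, add_div]
      refine add_le_add hsum (hline.trans ?_)
      rw [show 32 * π * Real.exp 246 / η.re * Real.exp (-(π * η.im)) * √π =
        K' * Real.exp (-(π * η.im)) / η.re by rw [hK']; ring]
      gcongr
    calc _ ≤ (K + K') * Real.exp (-(π * η.im)) / (η.re * a ^ 4) /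
          (a * Real.exp (-(π * η.im)) / 6) := div_le_div₀ (by positivity) herr (by positivity) hlow
      _ = _ := by field_simp

/-- In the region of the theorem the saddle point keeps away from the real axis. -/
theorem log_le_re_eta_mul {s : ℂ} (ht : Real.exp 1 ≤ s.im)
    (h : s.im ^ (2 / 5 : ℝ) * Real.log s.im ≤ 1 - s.re) :
    Real.log s.im ≤ (4 * π) ^ 5 * ((eta s).re * (min (eta s).im 1) ^ 5) := by
  have hπ := Real.pi_gt_three
  have hπ4 := Real.pi_lt_d2
  set t := s.im with htd
  set ℓ := Real.log t with hℓ
  have ht2 : 2 ≤ t := by linarith [Real.add_one_le_exp (1 : ℝ)]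
  have ht0 : 0 < t := by linarith
  have hℓ1 : 1 ≤ ℓ := by rw [hℓ, Real.le_log_iff_exp_le ht0]; exact ht
  have htp : 0 < t ^ (2 / 5 : ℝ) := Real.rpow_pos_of_pos ht0 _
  obtain ⟨hy, hyX⟩ := eta_pos (s := s) ht0 (by
    have : 0 < t ^ (2 / 5 : ℝ) * ℓ := by positivity
    linarith)
  have him := im_eq s
  rw [← htd] at him
  rw [one_sub_re_eq] at h
  set X := (eta s).re
  set y := (eta s).im
  have hX0 : 0 < X := by linarith
  have h4π : 1 ≤ (4 * π) ^ 5 := one_le_pow₀ (by linarith)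
  rcases le_total y 1 with hy1 | hy1
  · rw [min_eq_left hy1]
    -- Source of the exponent `2/5`: with `X² ≤ t`, the fifth power of the hypothesis reads `t² ℓ⁵ ≤
    -- (4π)⁵ X⁴ · X y⁵ ≤ (4π)⁵ t² · X y⁵`.
    have hXt : X ^ 2 ≤ t := by
      have : y ^ 2 ≤ 1 := pow_le_one₀ hy.le hy1
      nlinarith
    have h5 : (t ^ (2 / 5 : ℝ) * ℓ) ^ 5 ≤ (4 * π * X * y) ^ 5 := by gcongr
    have htpow : (t ^ (2 / 5 : ℝ)) ^ 5 = t ^ 2 := by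
      rw [← Real.rpow_natCast, ← Real.rpow_mul ht0.le, ← Real.rpow_natCast]; norm_num
    rw [mul_pow, htpow] at h5
    have hX4 : X ^ 4 ≤ t ^ 2 := by
      calc X ^ 4 = (X ^ 2) ^ 2 := by ring
        _ ≤ t ^ 2 := by gcongr
    have h6 : t ^ 2 * ℓ ^ 5 ≤ t ^ 2 * ((4 * π) ^ 5 * (X * y ^ 5)) := by
      refine h5.trans ?_
      calc (4 * π * X * y) ^ 5 = X ^ 4 * ((4 * π) ^ 5 * (X * y ^ 5)) := by ring
        _ ≤ _ := by gcongr
    have h7 := le_of_mul_le_mul_left h6 (by positivity)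
    exact (le_self_pow₀ hℓ1 (by norm_num)).trans h7
  · rw [min_eq_right hy1, one_pow, mul_one]
    have h8 : ℓ ≤ 2 * √t := by
      have h9 := Real.log_le_sub_one_of_pos (Real.sqrt_pos.2 ht0)
      rw [Real.log_sqrt ht0.le] at h9
      linarith
    have h10 : √t ≤ 3 * X := by
      rw [Real.sqrt_le_left (by positivity)]
      nlinarith
    have h11 : 6 ≤ (4 * π) ^ 5 := by
      calc (6 : ℝ) ≤ 4 * π := by linarith
        _ ≤ (4 * π) ^ 5 := le_self_pow₀ (by linarith) (by norm_num)
    nlinarith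

end RiemannAux

theorem mainTheorem2 :
    ∃ A t₀ C : ℝ, 0 < A ∧ 0 < t₀ ∧ 0 < C ∧
      ∀ s : ℂ, t₀ < s.im → A * s.im ^ (2 / 5 : ℝ) * Real.log s.im ≤ 1 - s.re →
        ∃ U : ℂ, RiemannAux.auxR s = RiemannAux.mainTerm s * (1 + U) ∧
          ‖U‖ < 1 ∧ ‖U‖ ≤ C * Real.log s.im ^ (-(1 / 5) : ℝ) := by
  have hpi := Real.pi_pos
  obtain ⟨K, hK0, hK⟩ := RiemannAux.exists_auxR_eq_mainTerm_mul
  set P : ℝ := (4 * Real.pi) ^ 5 with hP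
  have hP0 : 0 < P := by positivity
  -- `P * (K + 1)` forces `M ≥ K + 1`, hence `‖U‖ ≤ K/M < 1`; the summand `3` forces `s.re < -1` and
  -- `t ≥ e`.
  refine ⟨1, Real.exp (P * (K + 1) + 3), K * P, one_pos, Real.exp_pos _, by positivity,
    fun s ht hσ => ?_⟩
  rw [one_mul] at hσ
  have hPK : 0 < P * (K + 1) := by positivity
  have ht0 : 0 < s.im := (Real.exp_pos _).trans ht
  have hℓ : P * (K + 1) + 3 < Real.log s.im := (Real.lt_log_iff_exp_lt ht0).2 ht
  have hte : Real.exp 1 ≤ s.im := (Real.exp_le_exp.2 (by linarith)).trans ht.le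
  have ht1 : 1 ≤ s.im := (Real.one_le_exp (by norm_num)).trans hte
  have hpow : 1 ≤ s.im ^ (2 / 5 : ℝ) := Real.one_le_rpow ht1 (by norm_num)
  have hs : s.re < -1 := by nlinarith
  have hlog := RiemannAux.log_le_re_eta_mul hte hσ
  set ℓ := Real.log s.im with hℓd
  set M := (RiemannAux.eta s).re * (min (RiemannAux.eta s).im 1) ^ 5 with hM
  have hM1 : K + 1 ≤ M := by
    refine le_of_mul_le_mul_left ?_ hP0
    linarith
  obtain ⟨U, hU1, hU2⟩ := hK s ht0 hs (by linarith)
  refine ⟨U, hU1, hU2.trans_lt ?_, hU2.trans ?_⟩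
  · rw [div_lt_one (by linarith)]; linarith
  · have hℓ0 : 0 < ℓ := by linarith
    calc K / M ≤ K / (ℓ / P) := by
          gcongr
          rw [div_le_iff₀' hP0]
          exact hlog
      _ = K * P * ℓ ^ (-1 : ℝ) := by rw [Real.rpow_neg_one]; field_simp
      _ ≤ _ := by
          gcongr
          · linarith
          · norm_num
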